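/- **Sequences and trees.** All sequences below are sequences of ordinals unless said otherwise. For an ordinal $\zeta$ and a sequence $t=(\zeta_i)$ put $\zeta+t=(\zeta+\zeta_i)$ and, for a set $T$ of sequences, $\zeta+T=\{\zeta+t:t\in T\}$; $s\smallfrown t$ denotes concatenation, $\tau|n$ the initial segment of length $n$, and $MAX(T)$ the set of members of $T$ that are maximal for the initial-segment order. For each ordinal $\xi$ define sets $\Gamma_{\xi,n}$ ($n\geqslant 1$) of finite non-empty sequences and weights $\mathbb P_{\xi,n}:\Gamma_{\xi,n}\to[0,1]$ by recursion: * $\Gamma_{0,1}=\{(0)\}$, $\mathbb P_{0,1}((0))=1$; * $\Gamma_{\xi,n+1}=(\omega^\xi n+\Gamma_{\xi,1})\cup\{s\smallfrown t: s\in MAX(\omega^\xi n+\Gamma_{\xi,1}),\ t\in\Gamma_{\xi,n}\}$, with $\mathbb P_{\xi,n+1}(\omega^\xi n+t)=\mathbb P_{\xi,1}(t)$ and $\mathbb P_{\xi,n+1}(s\smallfrown t)=\mathbb P_{\xi,n}(t)$; * $\Gamma_{\xi+1,1}=\bigcup_{n\geqslant1}\Gamma_{\xi,n}$ with $\mathbb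 P_{\xi+1,1}=\frac1n\mathbb P_{\xi,n}$ on $\Gamma_{\xi,n}$; * $\Gamma_{\xi,1}=\bigcup_{\zeta<\xi}(\omega^\zeta+\Gamma_{\zeta+1,1})$ for $\xi$ a limit, with $\mathbb P_{\xi,1}(\omega^\zeta+t)=\mathbb P_{\zeta+1,1}(t)$. Let $\Lambda_{\xi,\infty,1}=\Gamma_{\xi,1}$, $\Lambda_{\xi,\infty,i+1}=\{s\smallfrown(\omega^\xi i+t): s\in MAX(\Lambda_{\xi,\infty,i}),\ t\in\Gamma_{\xi,1}\}$, $\Gamma_{\xi,\infty}=\bigcup_{i\geqslant1}\Lambda_{\xi,\infty,i}$ (a disjoint union), with $\mathbb P_{\xi,\infty}=\mathbb P_{\xi,1}$ on $\Lambda_{\xi,\infty,1}$ and $\mathbb P_{\xi,\infty}(s\smallfrown(\omega^\xi i+t))=\mathbb P_{\xi,1}(t)$. Let $[\Gamma_{\xi,\infty}]$ be the set of infinite sequences all of whose non-empty finite initial segments belong to $\Gamma_{\xi,\infty}$. For $\tau\in[\Gamma_{\xi,\infty}]$, only finitely many initial segments of $\tau$ belong to any one level $\Lambda_{\xi,\infty,n}$.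 **The game.** Let $\Omega$ be a compact Hausdorff space, $C(\Omega)$ the space of continuous scalar-valued functions on $\Omega$ (real or complex scalars) with the sup-norm, $\mathfrak f_{C(\Omega)}$ the set of finite non-empty subsets of its closed unit ball, and $\mathrm{an}(N)=\{f\in C(\Omega): f|_N\equiv0\}$ for $N\subset\Omega$. In the $n$-th turn ($n=1,2,\dots$) Player S chooses an ordinal $\zeta_n$ such that $(\zeta_1,\dots,\zeta_n)\in\Gamma_{\xi,\infty}$ and a set $\mathrm{an}(N_n)$ with $N_n\subset\Omega$ finite and non-empty; then Player V chooses $F_n\in\mathfrak f_{C(\Omega)}$ with $F_n\subset\mathrm{an}(N_n)$. A strategy for Player S is a function which assigns to each finite sequence $((\zeta_i,F_i))_{i=1}^{n}$ ($n\geqslant0$) with $F_i\in\mathfrak f_{C(\Omega)}$ and, if $n\geqslant 1$, $(\zeta_i)_{i=1}^n\in\Gamma_{\xi,\infty}$, a choice $(\zeta_{n+1},\mathrm{an}(N_{n+1}))$ with $(\zeta_i)_{i=1}^{n+1}\in\Gamma_{\xi,\infty}$. Given $C>0$, Player S wins the play $((\zeta_n,F_n))_{n=1}^\infty$, $\tau=(\zeta_n)_{n=1}^\infty\in[\Gamma_{\xi,\infty}]$,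 if for every choice of $f_k\in F_k$ ($k\geqslant1$) and every $m$, $$\Bigl\|\sum_{n=1}^m\ \sum_{k\,:\,\tau|k\in\Lambda_{\xi,\infty,n}}\mathbb P_{\xi,\infty}(\tau|k)\,|f_k|\Bigr\|\leqslant C.$$ The strategy is winning if Player S wins every play in which Player S's choices follow it and Player V's choices are legal. **Lemma.** Let $\xi$ be an ordinal, $r$ a positive integer, and $\Omega$ a scattered compact Hausdorff space whose transfinite Cantor–Bendixson derivatives satisfy $\Omega^{\omega^\xi(r-1)}\neq\varnothing$ and $\Omega^{\omega^\xi r}=\varnothing$. Then for every $C>2^r$ Player S has a winning strategy in this game. -/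

import Mathlib

universe u

noncomputable section

namespace CKGame

/-! ### Finite and infinite sequences, trees -/

/-- The initial segment of length `n` of an infinite sequence. -/
def initSeg {A : Type*} (τ : ℕ → A) (n : ℕ) : List A := (List.range n).map τ

/-- The body `[T]` of a tree `T` of non-empty finite sequences. -/
def treeBody {A : Type*} (T : Set (List A)) : Set (ℕ → A) :=
  {τ | ∀ n, 1 ≤ n → initSeg τ n ∈ T}

/-- `T.𝔤`: finite sequences of pairs, the first coordinates forming a member of `T`, the second
coordinates taken from `𝔤`. -/
def treeDot {A B : Type*} (T : Set (List A)) (𝔤 : Set B) : Set (List (A × B)) :=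
  {a | a.map Prod.fst ∈ T ∧ ∀ x ∈ a, x.2 ∈ 𝔤}

/-- `[T].𝔤`: infinite sequences of pairs, the first coordinates forming a member of `[T]`, the
second coordinates taken from `𝔤`. -/
def bodyDot {A B : Type*} (T : Set (List A)) (𝔤 : Set B) : Set (ℕ → A × B) :=
  {α | (fun n => (α n).1) ∈ treeBody T ∧ ∀ n, (α n).2 ∈ 𝔤}

/-! ### The game

In each turn Player S chooses `(ζ, u)` with `u ∈ D`, such that `ζ` extends the sequence of the
previous `ζ`'s to a member of `T`; Player V answers with some `G ∈ 𝔤`, `G ⊆ u`.  Player S wins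
if the resulting sequence of pairs `(ζ, G)` belongs to the target set `E`. -/

/-- `χ` is a strategy for Player S. Only its values on `{∅} ∪ T.𝔤` matter. -/
structure IsStrategyS {A X : Type*} (D 𝔤 : Set (Set X)) (T : Set (List A))
    (χ : List (A × Set X) → A × Set X) : Prop where
  set_mem : ∀ a, a = [] ∨ a ∈ treeDot T 𝔤 → (χ a).2 ∈ D
  node_mem : ∀ a, a = [] ∨ a ∈ treeDot T 𝔤 → a.map Prod.fst ++ [(χ a).1] ∈ T

/-- The infinite play `α` (a sequence of pairs `(ζ, G)`) is one in which Player S follows `χ`, and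
the answers of Player V are legal. -/
def Admissible {A X : Type*} (χ : List (A × Set X) → A × Set X) (α : ℕ → A × Set X) : Prop :=
  ∀ n, (α n).1 = (χ (initSeg α n)).1 ∧ (α n).2 ⊆ (χ (initSeg α n)).2

/-- `χ` is a winning strategy for Player S in the game with target set `E`. -/
def IsWinningStrategyS {A X : Type*} (E : Set (ℕ → A × Set X)) (D 𝔤 : Set (Set X))
    (T : Set (List A)) (χ : List (A × Set X) → A × Set X) : Prop :=
  IsStrategyS D 𝔤 T χ ∧ ∀ α ∈ bodyDot T 𝔤, Admissible χ α → α ∈ E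

/-! ### The trees `Γ_{ξ,1}`, `Γ_{ξ,∞}` and their weights

A tree `Γ` together with a weight function `ℙ : Γ → [0,1]` is represented by the graph of `ℙ`,
that is by the set of pairs `(t, ℙ t)`, `t ∈ Γ`. -/

/-- A set of pairs `(t, ℙ t)`. -/
abbrev WTree := Set (List Ordinal.{u} × ℝ)

/-- The underlying tree. -/
def nodes (G : WTree.{u}) : Set (List Ordinal.{u}) := Prod.fst '' G

/-- The maximal nodes (for the initial segment ordering). -/
def maxNodes (G : WTree.{u}) : Set (List Ordinal.{u}) :=
  {s | s ∈ nodes G ∧ ∀ t ∈ nodes G, s <+: t → t = s}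

/-- `ζ + t`, the ordinal `ζ` being added on the left to each entry of `t`. -/
def shiftList (ζ : Ordinal.{u}) (t : List Ordinal.{u}) : List Ordinal.{u} := t.map (ζ + ·)

/-- `ζ + G`; the node `ζ + t` has the weight of `t`. -/
def shift (ζ : Ordinal.{u}) (G : WTree.{u}) : WTree.{u} :=
  {q | ∃ p ∈ G, q = (shiftList ζ p.1, p.2)}

/-- For `β = ω ^ ξ` and `G = Γ_{ξ,1}`, this is `Γ_{ξ,n}` with the weight `ℙ_{ξ,n}`:
`Γ_{ξ,n+1}` consists of `β n + Γ_{ξ,1}` and of the concatenations of a maximal member of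
`β n + Γ_{ξ,1}` with a member of `Γ_{ξ,n}`. -/
def stack (β : Ordinal.{u}) (G : WTree.{u}) : ℕ → WTree.{u}
  | 0 => ∅
  | n + 1 => shift (β * n) G ∪
      {q | ∃ s ∈ maxNodes (shift (β * n) G), ∃ p ∈ stack β G n, q = (s ++ p.1, p.2)}

/-- `Γ_{ξ,1}` with the weight `ℙ_{ξ,1}`. -/
def gammaOne (ξ : Ordinal.{u}) : WTree.{u} :=
  Ordinal.limitRecOn ξ
    {([0], 1)}
    (fun ζ G => {q | ∃ n : ℕ, 1 ≤ n ∧ ∃ p ∈ stack (Ordinal.omega0 ^ ζ) G n,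
      q = (p.1, 1 / (n : ℝ) * p.2)})
    (fun ξ hξ IH => {q | ∃ (ζ : Ordinal.{u}) (hζ : ζ < ξ),
      q ∈ shift (Ordinal.omega0 ^ ζ) (IH (ζ + 1) (hξ.add_one_lt hζ))})

theorem gammaOne_zero : gammaOne.{u} 0 = {([0], 1)} := by
  simp [gammaOne]

theorem gammaOne_add_one (ζ : Ordinal.{u}) :
    gammaOne (ζ + 1) = {q | ∃ n : ℕ, 1 ≤ n ∧
      ∃ p ∈ stack (Ordinal.omega0 ^ ζ) (gammaOne ζ) n, q = (p.1, 1 / (n : ℝ) * p.2)} := by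
  simp only [gammaOne, Ordinal.limitRecOn_add_one]

theorem gammaOne_limit {ξ : Ordinal.{u}} (hξ : Order.IsSuccLimit ξ) :
    gammaOne ξ = {q | ∃ ζ < ξ, q ∈ shift (Ordinal.omega0 ^ ζ) (gammaOne (ζ + 1))} := by
  simp only [gammaOne, Ordinal.limitRecOn_limit _ _ _ _ hξ, exists_prop]

/-- The level `Λ_{ξ,∞,i+1}` of `Γ_{ξ,∞}` with its weights (levels are indexed from `0` here). -/
def infLevel (ξ : Ordinal.{u}) : ℕ → WTree.{u}
  | 0 => gammaOne ξ
  | i + 1 => {q | ∃ s ∈ maxNodes (infLevel ξ i), ∃ p ∈ gammaOne ξ,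
      q = (s ++ shiftList (Ordinal.omega0 ^ ξ * ((i + 1 : ℕ) : Ordinal.{u})) p.1, p.2)}

/-- `Γ_{ξ,∞}` with the weight `ℙ_{ξ,∞}`. -/
def gammaInf (ξ : Ordinal.{u}) : WTree.{u} := ⋃ i, infLevel ξ i

open Classical in
/-- The weight of a node (unique, see below). -/
def weight (G : WTree.{u}) (t : List Ordinal.{u}) : ℝ :=
  if h : ∃ p, (t, p) ∈ G then h.choose else 0

/-! ### Facts on the trees: the weights are well defined, the levels of a branch are finite -/

/-- Each node has only one weight. -/
def Functional (G : WTree.{u}) : Prop := ∀ t p p', (t, p) ∈ G → (t, p') ∈ G → p = p'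

theorem weight_eq {G : WTree.{u}} (hG : Functional G) {t : List Ordinal.{u}} {p : ℝ}
    (h : (t, p) ∈ G) : weight G t = p := by
  have h' : ∃ p, (t, p) ∈ G := ⟨p, h⟩
  rw [weight, dif_pos h']
  exact hG _ _ _ h'.choose_spec h

/-- The members of `G` are non-empty strictly decreasing sequences in `[0, β)`. -/
def DecBelow (β : Ordinal.{u}) (G : WTree.{u}) : Prop :=
  ∀ t ∈ nodes G, t ≠ [] ∧ (∀ x ∈ t, x < β) ∧ t.Pairwise (· > ·)

theorem shiftList_injective (ζ : Ordinal.{u}) : Function.Injective (shiftList ζ) :=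
  List.map_injective_iff.2 fun _ _ h => by simpa using h

theorem Functional.shift {G : WTree.{u}} (hG : Functional G) (ζ : Ordinal.{u}) :
    Functional (shift ζ G) := by
  rintro t p p' ⟨⟨a, b⟩, h, e⟩ ⟨⟨a', b'⟩, h', e'⟩
  simp only [Prod.mk.injEq] at e e'
  obtain ⟨rfl, rfl⟩ := e
  obtain ⟨e1, rfl⟩ := e'
  have := shiftList_injective _ e1
  subst this
  exact hG _ _ _ h h'

theorem append_eq_of_split {β : Ordinal.{u}} {s s' t t' : List Ordinal.{u}}
    (hs : ∀ x ∈ s, β ≤ x) (hs' : ∀ x ∈ s', β ≤ x) (ht : ∀ x ∈ t, x < β) (ht' : ∀ x ∈ t', x < β)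
    (h : s ++ t = s' ++ t') : s = s' ∧ t = t' := by
  classical
  have f1 : ∀ l : List Ordinal.{u}, (∀ x ∈ l, β ≤ x) → l.filter (fun x => decide (β ≤ x)) = l :=
    fun l hl => List.filter_eq_self.2 (by simpa using hl)
  have f2 : ∀ l : List Ordinal.{u}, (∀ x ∈ l, x < β) → l.filter (fun x => decide (β ≤ x)) = [] :=
    fun l hl => List.filter_eq_nil_iff.2 (by simpa using hl)
  have h1 := congrArg (List.filter (fun x => decide (β ≤ x))) h
  rw [List.filter_append, List.filter_append, f1 s hs, f1 s' hs', f2 t ht, f2 t' ht',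
    List.append_nil, List.append_nil] at h1
  subst h1
  exact ⟨rfl, List.append_cancel_left h⟩

theorem append_eq_of_split' {β : Ordinal.{u}} {s s' t t' : List Ordinal.{u}}
    (hs : ∀ x ∈ s, x < β) (hs' : ∀ x ∈ s', x < β) (ht : ∀ x ∈ t, β ≤ x) (ht' : ∀ x ∈ t', β ≤ x)
    (h : s ++ t = s' ++ t') : s = s' ∧ t = t' := by
  have := congrArg List.reverse h
  rw [List.reverse_append, List.reverse_append] at this
  have := append_eq_of_split (β := β) (by simpa using ht) (by simpa using ht')
    (by simpa using hs) (by simpa using hs') this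
  simpa [and_comm] using this

theorem shift_props {β : Ordinal.{u}} {G : WTree.{u}} (hG : DecBelow β G) (ζ : Ordinal.{u}) :
    ∀ t ∈ nodes (shift ζ G), t ≠ [] ∧ (∀ x ∈ t, ζ ≤ x ∧ x < ζ + β) ∧ t.Pairwise (· > ·) := by
  rintro _ ⟨_, ⟨⟨a, b⟩, h, rfl⟩, rfl⟩
  obtain ⟨h1, h2, h3⟩ := hG a ⟨_, h, rfl⟩
  refine ⟨by simpa [shiftList] using h1, ?_, ?_⟩
  · intro x hx
    obtain ⟨y, hy, rfl⟩ := List.mem_map.1 hx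
    exact ⟨le_self_add, by simpa using h2 y hy⟩
  · simpa [shiftList, List.pairwise_map] using h3

theorem stack_props {β : Ordinal.{u}} {G : WTree.{u}} (hG : DecBelow β G) (n : ℕ) :
    ∀ t ∈ nodes (stack β G n), (∃ x ∈ t, β * ((n - 1 : ℕ) : Ordinal.{u}) ≤ x) ∧
      (∀ x ∈ t, x < β * (n : Ordinal.{u})) ∧ t.Pairwise (· > ·) := by
  induction n with
  | zero => rintro _ ⟨_, h, rfl⟩; exact h.elim
  | succ n ih =>
    have hmul : β * ((n + 1 : ℕ) : Ordinal.{u}) = β * n + β := by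
      rw [Nat.cast_add, Nat.cast_one, mul_add, mul_one]
    rintro _ ⟨⟨a, b⟩, h | ⟨s, hs, ⟨t, p⟩, hp, e⟩, rfl⟩
    · obtain ⟨h1, h2, h3⟩ := shift_props hG (β * n) a ⟨_, h, rfl⟩
      obtain ⟨x, hx⟩ := List.exists_mem_of_ne_nil a h1
      exact ⟨⟨x, hx, by simpa using (h2 x hx).1⟩, fun y hy => by rw [hmul]; exact (h2 y hy).2, h3⟩
    · simp only [Prod.mk.injEq] at e
      obtain ⟨rfl, rfl⟩ := e
      obtain ⟨h1, h2, h3⟩ := shift_props hG (β * n) s hs.1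
      obtain ⟨-, h5, h6⟩ := ih t ⟨_, hp, rfl⟩
      obtain ⟨x, hx⟩ := List.exists_mem_of_ne_nil s h1
      refine ⟨⟨x, by simp [hx], by simpa using (h2 x hx).1⟩, ?_, ?_⟩
      · intro y hy
        rw [hmul]
        rcases List.mem_append.1 hy with hy | hy
        · exact (h2 y hy).2
        · exact (h5 y hy).trans_le le_self_add
      · rw [List.pairwise_append]
        exact ⟨h3, h6, fun y hy z hz => (h5 z hz).trans_le (h2 y hy).1⟩

theorem Functional.stack {β : Ordinal.{u}} {G : WTree.{u}} (hG : DecBelow β G)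
    (hF : Functional G) (n : ℕ) : Functional (stack β G n) := by
  induction n with
  | zero => intro t p p' h; exact h.elim
  | succ n ih =>
    have key : ∀ t p p', (t, p) ∈ CKGame.shift (β * n) G →
        (∃ s ∈ maxNodes (CKGame.shift (β * n) G), ∃ q ∈ CKGame.stack β G n,
          (t, p') = (s ++ q.1, q.2)) → False := by
      rintro t p p' h ⟨s, hs, ⟨a, b⟩, hq, e⟩
      simp only [Prod.mk.injEq] at e
      obtain ⟨rfl, rfl⟩ := e
      have h1 := shift_props hG (β * n) _ ⟨_, h, rfl⟩
      obtain ⟨⟨x, hx, -⟩, h3, -⟩ := stack_props hG n a ⟨_, hq, rfl⟩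
      exact absurd (h3 x hx) (not_lt.2 (h1.2.1 x (by simp [hx])).1)
    rintro t p p' (h | h) (h' | h')
    · exact hF.shift _ _ _ _ h h'
    · exact (key _ _ _ h h').elim
    · exact (key _ _ _ h' h).elim
    · obtain ⟨s, hs, ⟨a, b⟩, hq, e⟩ := h
      obtain ⟨s', hs', ⟨a', b'⟩, hq', e'⟩ := h'
      simp only [Prod.mk.injEq] at e e'
      obtain ⟨rfl, rfl⟩ := e
      obtain ⟨e, rfl⟩ := e'
      have := append_eq_of_split
        (fun x hx => ((shift_props hG (β * n) s hs.1).2.1 x hx).1)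
        (fun x hx => ((shift_props hG (β * n) s' hs'.1).2.1 x hx).1)
        (stack_props hG n a ⟨_, hq, rfl⟩).2.1 (stack_props hG n a' ⟨_, hq', rfl⟩).2.1 e
      obtain ⟨-, rfl⟩ := this
      exact ih _ _ _ hq hq'

theorem omega0_opow_add_lt (ζ : Ordinal.{u}) :
    Ordinal.omega0 ^ ζ + Ordinal.omega0 ^ (ζ + 1) = Ordinal.omega0 ^ (ζ + 1) := by
  apply Ordinal.add_of_omega0_opow_le _ le_rfl
  exact (Ordinal.opow_lt_opow_iff_right Ordinal.one_lt_omega0).2 (lt_add_one ζ)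

theorem gammaOne_props (ξ : Ordinal.{u}) :
    DecBelow (Ordinal.omega0 ^ ξ) (gammaOne ξ) ∧ Functional (gammaOne ξ) := by
  induction ξ using WellFoundedLT.induction with
  | ind ξ IH =>
  rcases Ordinal.zero_or_succ_or_isSuccLimit ξ with rfl | ⟨ζ, hζ⟩ | hξ
  · rw [gammaOne_zero]
    refine ⟨?_, ?_⟩
    · rintro _ ⟨_, rfl, rfl⟩
      simp
    · intro t p p' h h'
      simp only [Set.mem_singleton_iff, Prod.mk.injEq] at h h'
      rw [h.2, h'.2]
  · obtain rfl : ξ = ζ + 1 := by rw [← hζ, Order.succ_eq_add_one]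
    obtain ⟨hD, hF⟩ := IH ζ (lt_add_one ζ)
    rw [gammaOne_add_one]
    refine ⟨?_, ?_⟩
    · rintro _ ⟨_, ⟨n, hn, ⟨t, p⟩, hp, rfl⟩, rfl⟩
      obtain ⟨⟨x, hx, -⟩, h2, h3⟩ := stack_props hD n t ⟨_, hp, rfl⟩
      refine ⟨List.ne_nil_of_mem hx, fun y hy => (h2 y hy).trans ?_, h3⟩
      rw [Ordinal.opow_add, Ordinal.opow_one]
      exact mul_lt_mul_of_pos_left (Ordinal.natCast_lt_omega0 n)
        (Ordinal.opow_pos ζ Ordinal.omega0_pos)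
    · rintro t p p' ⟨n, hn, ⟨a, b⟩, h, e⟩ ⟨m, hm, ⟨a', b'⟩, h', e'⟩
      simp only [Prod.mk.injEq] at e e'
      obtain ⟨rfl, rfl⟩ := e
      obtain ⟨rfl, rfl⟩ := e'
      have key : ∀ n m : ℕ, ∀ b b' : ℝ, 1 ≤ m → (t, b) ∈ stack (Ordinal.omega0 ^ ζ) (gammaOne ζ) n →
          (t, b') ∈ stack (Ordinal.omega0 ^ ζ) (gammaOne ζ) m → ¬ n < m := by
        intro n m b b' hm h h' hlt
        obtain ⟨⟨x, hx, h1⟩, -, -⟩ := stack_props hD m t ⟨_, h', rfl⟩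
        have h2 := (stack_props hD n t ⟨_, h, rfl⟩).2.1 x hx
        have h3 : Ordinal.omega0 ^ ζ * (n : Ordinal.{u}) ≤
            Ordinal.omega0 ^ ζ * ((m - 1 : ℕ) : Ordinal.{u}) :=
          mul_le_mul_right (by exact_mod_cast (by omega : n ≤ m - 1)) _
        exact absurd (h2.trans_le (h3.trans h1)) (lt_irrefl _)
      have : n = m := le_antisymm (not_lt.1 (key _ _ _ _ hn h' h)) (not_lt.1 (key _ _ _ _ hm h h'))
      subst this
      rw [Functional.stack hD hF n _ _ _ h h']
  · rw [gammaOne_limit hξ]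
    have bd : ∀ ζ < ξ, ∀ t ∈ nodes (shift (Ordinal.omega0 ^ ζ) (gammaOne (ζ + 1))),
        t ≠ [] ∧ (∀ x ∈ t, Ordinal.omega0 ^ ζ ≤ x ∧ x < Ordinal.omega0 ^ (ζ + 1)) ∧
          t.Pairwise (· > ·) := by
      intro ζ hζ t ht
      have := shift_props (IH (ζ + 1) (hξ.add_one_lt hζ)).1 (Ordinal.omega0 ^ ζ) t ht
      rwa [omega0_opow_add_lt] at this
    refine ⟨?_, ?_⟩
    · rintro _ ⟨⟨a, b⟩, ⟨ζ, hζ, h⟩, rfl⟩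
      obtain ⟨h1, h2, h3⟩ := bd ζ hζ a ⟨_, h, rfl⟩
      exact ⟨h1, fun x hx => (h2 x hx).2.trans_le
        (Ordinal.opow_le_opow_right Ordinal.omega0_pos (hξ.add_one_lt hζ).le), h3⟩
    · rintro t p p' ⟨ζ, hζ, h⟩ ⟨ζ', hζ', h'⟩
      have key : ∀ ζ ζ' : Ordinal.{u}, ζ < ξ → ζ' < ξ → ∀ p p',
          (t, p) ∈ shift (Ordinal.omega0 ^ ζ) (gammaOne (ζ + 1)) →
          (t, p') ∈ shift (Ordinal.omega0 ^ ζ') (gammaOne (ζ' + 1)) → ¬ ζ < ζ' := by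
        intro ζ ζ' hζ hζ' p p' h h' hlt
        obtain ⟨h1, h2, -⟩ := bd ζ hζ t ⟨_, h, rfl⟩
        obtain ⟨x, hx⟩ := List.exists_mem_of_ne_nil t h1
        have h3 := ((bd ζ' hζ' t ⟨_, h', rfl⟩).2.1 x hx).1
        exact absurd ((h2 x hx).2.trans_le ((Ordinal.opow_le_opow_right Ordinal.omega0_pos
          (Order.add_one_le_of_lt hlt)).trans h3)) (lt_irrefl _)
      have : ζ = ζ' := le_antisymm (not_lt.1 (key _ _ hζ' hζ _ _ h' h))
        (not_lt.1 (key _ _ hζ hζ' _ _ h h'))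
      subst this
      exact (IH (ζ + 1) (hξ.add_one_lt hζ)).2.shift _ _ _ _ h h'

theorem infLevel_eq (ξ : Ordinal.{u}) (i : ℕ) {q : List Ordinal.{u} × ℝ} (hq : q ∈ infLevel ξ i) :
    ∃ s u, q.1 = s ++ shiftList (Ordinal.omega0 ^ ξ * (i : Ordinal.{u})) u ∧
      (u, q.2) ∈ gammaOne ξ ∧ ∀ x ∈ s, x < Ordinal.omega0 ^ ξ * (i : Ordinal.{u}) := by
  induction i generalizing q with
  | zero => exact ⟨[], q.1, by simp [shiftList], hq, by simp⟩
  | succ i ih =>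
    obtain ⟨s, ⟨⟨q', hq', hs⟩, -⟩, ⟨u, p⟩, hp, rfl⟩ := hq
    refine ⟨s, u, rfl, hp, ?_⟩
    obtain ⟨s', u', e, hu, hlt⟩ := ih hq'
    have hmul : Ordinal.omega0 ^ ξ * ((i + 1 : ℕ) : Ordinal.{u}) =
        Ordinal.omega0 ^ ξ * i + Ordinal.omega0 ^ ξ := by
      rw [Nat.cast_add, Nat.cast_one, mul_add, mul_one]
    intro x hx
    rw [← hs, e, List.mem_append] at hx
    rw [hmul]
    rcases hx with hx | hx
    · exact (hlt x hx).trans_le le_self_add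
    · obtain ⟨y, hy, rfl⟩ := List.mem_map.1 hx
      simpa using ((gammaOne_props ξ).1 u' ⟨_, hu, rfl⟩).2.1 y hy

theorem infLevel_last {ξ : Ordinal.{u}} {i : ℕ} {t : List Ordinal.{u}}
    (ht : t ∈ nodes (infLevel ξ i)) :
    ∃ h : t ≠ [], Ordinal.omega0 ^ ξ * (i : Ordinal.{u}) ≤ t.getLast h ∧
      t.getLast h < Ordinal.omega0 ^ ξ * ((i + 1 : ℕ) : Ordinal.{u}) := by
  obtain ⟨q, hq, rfl⟩ := ht
  obtain ⟨s, u, e, hu, -⟩ := infLevel_eq ξ i hq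
  have hmul : Ordinal.omega0 ^ ξ * ((i + 1 : ℕ) : Ordinal.{u}) =
      Ordinal.omega0 ^ ξ * i + Ordinal.omega0 ^ ξ := by
    rw [Nat.cast_add, Nat.cast_one, mul_add, mul_one]
  obtain ⟨h1, h2, -⟩ := (gammaOne_props ξ).1 u ⟨_, hu, rfl⟩
  have h1' : shiftList (Ordinal.omega0 ^ ξ * (i : Ordinal.{u})) u ≠ [] := by
    simpa [shiftList] using h1
  have hne : q.1 ≠ [] := by rw [e]; simp [h1']
  refine ⟨hne, ?_⟩
  have hl : q.1.getLast hne = (shiftList (Ordinal.omega0 ^ ξ * (i : Ordinal.{u})) u).getLast h1' := by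
    simp only [e]
    exact List.getLast_append_of_ne_nil _ h1'
  rw [hl]
  obtain ⟨y, hy, e'⟩ := List.mem_map.1 (List.getLast_mem h1')
  rw [← e', hmul]
  exact ⟨le_self_add, by simpa using h2 y hy⟩

/-- The levels of `Γ_{ξ,∞}` are disjoint. -/
theorem infLevel_index_unique {ξ : Ordinal.{u}} {i j : ℕ} {t : List Ordinal.{u}}
    (hi : t ∈ nodes (infLevel ξ i)) (hj : t ∈ nodes (infLevel ξ j)) : i = j := by
  have key : ∀ i j, t ∈ nodes (infLevel ξ i) → t ∈ nodes (infLevel ξ j) → ¬ i < j := by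
    intro i j hi hj hlt
    obtain ⟨h, -, h2⟩ := infLevel_last hi
    obtain ⟨h', h3, -⟩ := infLevel_last hj
    have h4 : Ordinal.omega0 ^ ξ * ((i + 1 : ℕ) : Ordinal.{u}) ≤
        Ordinal.omega0 ^ ξ * (j : Ordinal.{u}) :=
      mul_le_mul_right (by exact_mod_cast hlt) _
    exact absurd (h2.trans_le (h4.trans h3)) (lt_irrefl _)
  exact le_antisymm (not_lt.1 (key _ _ hj hi)) (not_lt.1 (key _ _ hi hj))

/-- The weight `ℙ_{ξ,∞}` is well defined. -/
theorem functional_gammaInf (ξ : Ordinal.{u}) : Functional (gammaInf ξ) := by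
  intro t p p' h h'
  obtain ⟨i, h⟩ := Set.mem_iUnion.1 h
  obtain ⟨j, h'⟩ := Set.mem_iUnion.1 h'
  obtain rfl := infLevel_index_unique ⟨_, h, rfl⟩ ⟨_, h', rfl⟩
  obtain ⟨s, v, e, hv, hs⟩ := infLevel_eq ξ i h
  obtain ⟨s', v', e', hv', hs'⟩ := infLevel_eq ξ i h'
  have hge : ∀ v, ∀ x ∈ shiftList (Ordinal.omega0 ^ ξ * (i : Ordinal.{u})) v,
      Ordinal.omega0 ^ ξ * (i : Ordinal.{u}) ≤ x := by
    intro v x hx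
    obtain ⟨y, -, rfl⟩ := List.mem_map.1 hx
    exact le_self_add
  obtain ⟨-, h2⟩ := append_eq_of_split' hs hs' (hge v) (hge v') (e.symm.trans e')
  obtain rfl := shiftList_injective _ h2
  exact (gammaOne_props ξ).2 _ _ _ hv hv'

/-- The part of the infinite sequence `τ` that lies in the level `Λ_{ξ,∞,i+1}`: the index `k`
stands for the initial segment of `τ` of length `k + 1`, whose last entry is `τ k`. -/
def levelBlock (ξ : Ordinal.{u}) (τ : ℕ → Ordinal.{u}) (i : ℕ) : Set ℕ :=
  {k | initSeg τ (k + 1) ∈ nodes (infLevel ξ i)}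

theorem initSeg_getLast {A : Type*} (τ : ℕ → A) (k : ℕ) (h : initSeg τ (k + 1) ≠ []) :
    (initSeg τ (k + 1)).getLast h = τ k := by
  simp [initSeg, List.range_succ]

theorem levelBlock_finite (ξ : Ordinal.{u}) (τ : ℕ → Ordinal.{u}) (i : ℕ) :
    (levelBlock ξ τ i).Finite := by
  classical
  have key : ∀ j ∈ levelBlock ξ τ i, ∀ k ∈ levelBlock ξ τ i, j < k → τ k < τ j := by
    intro j hj k hk hjk
    have lastge : ∀ k ∈ levelBlock ξ τ i, Ordinal.omega0 ^ ξ * (i : Ordinal.{u}) ≤ τ k := by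
      intro k hk
      obtain ⟨h, h1, -⟩ := infLevel_last hk
      rwa [initSeg_getLast] at h1
    obtain ⟨q, hq, e0⟩ := hk
    obtain ⟨s, v, e, hv, hs⟩ := infLevel_eq ξ i hq
    have hpw := ((gammaOne_props ξ).1 v ⟨_, hv, rfl⟩).2.2
    have hsub : List.Sublist [τ j, τ k] (initSeg τ (k + 1)) := by
      rw [initSeg, List.range_succ, List.map_append]
      exact List.Sublist.append (l₁ := [τ j])
        (List.singleton_sublist.2 (List.mem_map.2 ⟨j, List.mem_range.2 hjk, rfl⟩))
        (List.Sublist.refl _)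
    have hf := hsub.filter (fun x => decide (Ordinal.omega0 ^ ξ * (i : Ordinal.{u}) ≤ x))
    have f1 : ∀ l : List Ordinal.{u}, (∀ x ∈ l, Ordinal.omega0 ^ ξ * (i : Ordinal.{u}) ≤ x) →
        l.filter (fun x => decide (Ordinal.omega0 ^ ξ * (i : Ordinal.{u}) ≤ x)) = l :=
      fun l hl => List.filter_eq_self.2 (by simpa using hl)
    have f2 : ∀ l : List Ordinal.{u}, (∀ x ∈ l, x < Ordinal.omega0 ^ ξ * (i : Ordinal.{u})) →
        l.filter (fun x => decide (Ordinal.omega0 ^ ξ * (i : Ordinal.{u}) ≤ x)) = [] :=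
      fun l hl => List.filter_eq_nil_iff.2 (by simpa using hl)
    rw [← e0, e, List.filter_append, f2 s hs, f1 (shiftList _ v) (by simp [shiftList]),
      f1 [τ j, τ k] (by simpa using ⟨lastge j hj, lastge k ⟨q, hq, e0⟩⟩), List.nil_append] at hf
    have hpw' : (shiftList (Ordinal.omega0 ^ ξ * (i : Ordinal.{u})) v).Pairwise (· > ·) := by
      simpa [shiftList, List.pairwise_map] using hpw
    simpa using hpw'.sublist hf
  by_contra hinf
  have hinf : (levelBlock ξ τ i).Infinite := hinf
  have hanti : StrictAnti fun n => τ (Nat.nth (· ∈ levelBlock ξ τ i) n) := by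
    intro a b hab
    exact key _ (Nat.nth_mem_of_infinite hinf a) _ (Nat.nth_mem_of_infinite hinf b)
      (Nat.nth_strictMono hinf hab)
  exact not_strictAnti_of_wellFoundedLT _ hanti

/-! ### Scattered spaces and the game on `C(Ω)` -/

/-- Every non-empty subset has a relatively isolated point. -/
def IsScattered (Ω : Type*) [TopologicalSpace Ω] : Prop :=
  ∀ S : Set Ω, S.Nonempty → ∃ x ∈ S, ∃ U : Set Ω, IsOpen U ∧ U ∩ S = {x}

section CK

variable (𝕜 : Type*) [RCLike 𝕜] (Ω : Type u) [TopologicalSpace Ω] [CompactSpace Ω]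

/-- `{f ∈ C(Ω) : f = 0 on N}`. -/
def an (N : Set Ω) : Set C(Ω, 𝕜) := {f | ∀ x ∈ N, f x = 0}

/-- The sets that Player S may choose: the sets `an N`, for `N` a finite non-empty subset of `Ω`. -/
def finiteAn : Set (Set C(Ω, 𝕜)) := {u | ∃ N : Set Ω, N.Finite ∧ N.Nonempty ∧ u = an 𝕜 Ω N}

/-- The finite non-empty subsets of the closed unit ball of `C(Ω)`. -/
def finiteBallSets : Set (Set C(Ω, 𝕜)) :=
  {F | F.Finite ∧ F.Nonempty ∧ F ⊆ Metric.closedBall 0 1}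

variable {𝕜 Ω}

/-- The function `|f|`. -/
def absFun (f : C(Ω, 𝕜)) : C(Ω, ℝ) := ⟨fun x => ‖f x‖, by fun_prop⟩

/-- The sum, over the initial segments `a` of `τ` in the levels `Λ_{ξ,∞,1}, …, Λ_{ξ,∞,m}`, of
`ℙ_{ξ,∞}(a) |f_a|`. -/
def partialSum (ξ : Ordinal.{u}) (τ : ℕ → Ordinal.{u}) (f : ℕ → C(Ω, 𝕜)) (m : ℕ) : C(Ω, ℝ) :=
  ∑ n ∈ Finset.range m, ∑ k ∈ (levelBlock_finite ξ τ n).toFinset,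
    weight (gammaInf ξ) (initSeg τ (k + 1)) • absFun (f k)

variable (𝕜 Ω) in
/-- The target set: all plays `(ζ_k, F_k)_k` such that for all choices of `f_k ∈ F_k`, all the
partial sums have norm at most `C`. -/
def targetSet (ξ : Ordinal.{u}) (C : ℝ) : Set (ℕ → Ordinal.{u} × Set C(Ω, 𝕜)) :=
  {α | α ∈ bodyDot (nodes (gammaInf ξ)) (finiteBallSets 𝕜 Ω) ∧
    ∀ f : ℕ → C(Ω, 𝕜), (∀ k, f k ∈ (α k).2) →
      ∀ m, ‖partialSum ξ (fun k => (α k).1) f m‖ ≤ C}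

end CK

end CKGame

end

namespace CKGame

open Ordinal OrdinalApprox CantorBendixson

/-! ### Iterated derived sets -/

section Derived

variable {X : Type u} [TopologicalSpace X]

/-! Only the pointwise maxima of `|f|`, `f ∈ F`, matter, so Player V may be taken to answer with one
continuous `g : Ω → [0, 1]` vanishing on `N`. Put `β = ω ^ ξ`. Player S controls the running
weighted sum `T` by the invariant `RankBound`: for each `j ≤ r` the closed set `{T ≥ j - 1 + δ}` has
empty derivative of order `β (r - j)`. The case `j = r` says `T < r - 1 + δ`, so as long as `δ < 1`
all sums stay below `r < 2 ^ r`.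

One level costs an arbitrarily small increase of `δ`. Its critical set, the union over `j < r` of
the derivatives of order `β (r - 1 - j)` of `{T ≥ j - 1 + δ}`, has empty `β`-th derivative. If the
sum `h` of the level is at most `1` everywhere and less than `ε` on the critical set, the invariant
passes to `T + h` with `δ + ε` (`RankBound.add`).

That such an `h` can be forced is `isForcible_gammaOne`, proved by induction on `ξ`. For `ξ = 0` the
set to be controlled is finite and can serve as `N`. At a successor, compactness bounds its rank by
some `ω ^ ξ r`; the invariant, applied inside the level over many blocks of `Γ_{ξ,1}`, keeps their
sum below `r` on the set, and averaging over the blocks makes it small. At a limit, compactness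
reduces to a smaller exponent. -/

theorem iteratedDerivedSet_subset (s : Set X) (a : Ordinal.{u}) : iteratedDerivedSet s a ⊆ s := by
  simpa using iteratedDerivedSet_antitone s (bot_le : ⊥ ≤ a)

theorem iteratedDerivedSet_mono_right {s t : Set X} (h : s ⊆ t) (a : Ordinal.{u}) :
    iteratedDerivedSet s a ⊆ iteratedDerivedSet t a :=
  gfpApprox_mono_mid relDerivedSet h a

theorem iteratedDerivedSet_add (s : Set X) (a b : Ordinal.{u}) :
    iteratedDerivedSet (iteratedDerivedSet s a) b = iteratedDerivedSet s (a + b) := by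
  induction b using Ordinal.limitRecOn with
  | zero => simp
  | add_one b ih => rw [iteratedDerivedSet_succ, ih, ← add_assoc, iteratedDerivedSet_succ]
  | limit b hb ih =>
    rw [iteratedDerivedSet_limit hb, iteratedDerivedSet_limit (Ordinal.isSuccLimit_add a hb)]
    apply subset_antisymm
    · refine Set.subset_iInter fun c => ?_
      -- The ordinals `a + d` with `d < b` are cofinal in `a + b`.
      obtain ⟨d, hd, hcd⟩ := (Ordinal.lt_add_iff hb.ne_bot).1 c.2
      refine (Set.iInter_subset _ ⟨d, hd⟩).trans ?_
      rw [ih d hd]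
      exact iteratedDerivedSet_antitone s hcd
    · refine Set.subset_iInter fun c => ?_
      rw [ih c c.2]
      exact Set.iInter_subset _ (⟨a + c, add_lt_add_right c.2 a⟩ : Set.Iio (a + b))

/-- At a limit stage, a point lost from `s` at stage `b` and from `t` at stage `c` is lost from both
at stage `max b c`, which is still below the limit. -/
theorem iteratedDerivedSet_union_subset {s t : Set X} (hs : IsClosed s) (ht : IsClosed t)
    (a : Ordinal.{u}) :
    iteratedDerivedSet (s ∪ t) a ⊆ iteratedDerivedSet s a ∪ iteratedDerivedSet t a := by
  induction a using Ordinal.limitRecOn with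
  | zero => simp
  | add_one a ih =>
    simp only [iteratedDerivedSet_succ]
    rw [(isClosed_iteratedDerivedSet hs a).relDerivedSet_eq,
      (isClosed_iteratedDerivedSet ht a).relDerivedSet_eq, ← derivedSet_union]
    exact Set.inter_subset_left.trans (derivedSet_mono _ _ ih)
  | limit a ha ih =>
    intro x hx
    rw [iteratedDerivedSet_limit ha] at hx
    by_contra hcon
    simp only [Set.mem_union, not_or, iteratedDerivedSet_limit ha, Set.mem_iInter, not_forall] at hcon
    obtain ⟨⟨b, hb⟩, ⟨c, hc⟩⟩ := hcon
    have hmax : max b.1 c.1 < a := max_lt b.2 c.2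
    rcases ih _ hmax (Set.mem_iInter.1 hx ⟨_, hmax⟩) with h | h
    · exact hb (iteratedDerivedSet_antitone s (le_max_left _ _) h)
    · exact hc (iteratedDerivedSet_antitone t (le_max_right _ _) h)

theorem iteratedDerivedSet_biUnion_eq_empty (n : ℕ) {s : ℕ → Set X} (hs : ∀ j < n, IsClosed (s j))
    {a : Ordinal.{u}} (h : ∀ j < n, iteratedDerivedSet (s j) a = ∅) :
    iteratedDerivedSet (⋃ j < n, s j) a = ∅ := by
  induction n with
  | zero => simpa using iteratedDerivedSet_subset (∅ : Set X) a
  | succ n ih =>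
    rw [Set.biUnion_lt_succ]
    refine Set.subset_empty_iff.1 ((iteratedDerivedSet_union_subset
      ((Set.finite_lt_nat n).isClosed_biUnion fun j hj => hs j (Nat.lt_succ_of_lt hj))
      (hs n n.lt_succ_self) a).trans ?_)
    rw [show ⋃ i ∈ {i | i < n}, s i = ⋃ i < n, s i from rfl,
      ih (fun j hj => hs j (Nat.lt_succ_of_lt hj)) (fun j hj => h j (Nat.lt_succ_of_lt hj)),
      h n n.lt_succ_self, Set.union_empty]

/-- Compactness: a decreasing family of non-empty closed sets has a common point. This brings a rank
bound `ω ^ (ξ + 1)`, or `ω ^ ξ` with `ξ` a limit, down to a smaller ordinal. -/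
theorem exists_iteratedDerivedSet_eq_empty [CompactSpace X] {s : Set X} (hs : IsClosed s)
    {a : Ordinal.{u}} (ha : Order.IsSuccLimit a) (h : iteratedDerivedSet s a = ∅) :
    ∃ b < a, iteratedDerivedSet s b = ∅ := by
  by_contra! hcon
  have : Nonempty (Set.Iio a) := ⟨⟨0, ha.bot_lt⟩⟩
  have := IsCompact.nonempty_iInter_of_directed_nonempty_isCompact_isClosed
    (fun b : Set.Iio a => iteratedDerivedSet s b.1)
    ((iteratedDerivedSet_antitone s).comp_monotone (Subtype.mono_coe _)).directed_ge
    (fun b => hcon b b.2)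
    (fun b => (isClosed_iteratedDerivedSet hs b).isCompact)
    (fun b => isClosed_iteratedDerivedSet hs b)
  rw [← iteratedDerivedSet_limit ha, h] at this
  exact Set.not_nonempty_empty this

theorem finite_of_iteratedDerivedSet_one_eq_empty [CompactSpace X] {s : Set X} (hs : IsClosed s)
    (h : iteratedDerivedSet s (1 : Ordinal.{u}) = ∅) : s.Finite := by
  by_contra hinf
  obtain ⟨x, hx, hacc⟩ :=
    Set.Infinite.exists_accPt_of_subset_isCompact hinf hs.isCompact subset_rfl
  rw [← zero_add (1 : Ordinal.{u}), iteratedDerivedSet_succ, iteratedDerivedSet_zero] at h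
  exact Set.notMem_empty x (h ▸ ⟨hacc, hx⟩)

end Derived

/-! ### Maximal nodes -/

theorem mem_nodes {G : WTree.{u}} {t : List Ordinal.{u}} : t ∈ nodes G ↔ ∃ p, (t, p) ∈ G := by
  simp [nodes]

theorem mem_shift {ζ : Ordinal.{u}} {G : WTree.{u}} {t : List Ordinal.{u}} {p : ℝ} :
    (t, p) ∈ shift ζ G ↔ ∃ t', (t', p) ∈ G ∧ t = shiftList ζ t' := by
  constructor
  · rintro ⟨⟨a, b⟩, h, e⟩
    simp only [Prod.mk.injEq] at e
    obtain ⟨rfl, rfl⟩ := e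
    exact ⟨a, h, rfl⟩
  · rintro ⟨t', h, rfl⟩
    exact ⟨_, h, rfl⟩

theorem shiftList_mem_shift {ζ : Ordinal.{u}} {G : WTree.{u}} {t : List Ordinal.{u}} {p : ℝ}
    (h : (t, p) ∈ G) : (shiftList ζ t, p) ∈ shift ζ G := mem_shift.2 ⟨t, h, rfl⟩

theorem shiftList_mem_maxNodes_shift {ζ : Ordinal.{u}} {G : WTree.{u}} {t : List Ordinal.{u}}
    (h : t ∈ maxNodes G) : shiftList ζ t ∈ maxNodes (shift ζ G) := by
  obtain ⟨p, hp⟩ := mem_nodes.1 h.1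
  refine ⟨mem_nodes.2 ⟨p, shiftList_mem_shift hp⟩, fun u hu hpre => ?_⟩
  obtain ⟨q, hq⟩ := mem_nodes.1 hu
  obtain ⟨u', hu', rfl⟩ := mem_shift.1 hq
  rw [h.2 u' (mem_nodes.2 ⟨q, hu'⟩)
    ((List.prefix_map_iff_of_injective (fun a b e => by simpa using e)).1 hpre)]

/-- If the entries of `s`, `s'` satisfy `P` and those of `t`, `t'` do not, then `s ++ t` can be an
initial segment of `s' ++ t'` only if `s` is one of `s'`. -/
theorem prefix_of_append_prefix_append {A : Type*} (P : A → Prop) {s s' t t' : List A}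
    (hs : ∀ x ∈ s, P x) (hs' : ∀ x ∈ s', P x) (ht' : ∀ x ∈ t', ¬ P x)
    (h : s ++ t <+: s' ++ t') : s <+: s' := by
  classical
  have h1 := ((List.prefix_append s t).trans h).filter (fun x => decide (P x))
  rwa [List.filter_append, List.filter_eq_self.2 (by simpa using hs),
    List.filter_eq_self.2 (by simpa using hs'), List.filter_eq_nil_iff.2 (by simpa using ht'),
    List.append_nil] at h1

theorem mul_natCast_succ (β : Ordinal.{u}) (n : ℕ) :
    β * ((n + 1 : ℕ) : Ordinal.{u}) = β * n + β := by
  rw [Nat.cast_add, Nat.cast_one, mul_add, mul_one]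

theorem mem_maxNodes_stack_one {β : Ordinal.{u}} {G : WTree.{u}} {s : List Ordinal.{u}}
    (hs : s ∈ maxNodes (shift (β * (0 : ℕ)) G)) : s ∈ maxNodes (stack β G 1) := by
  have : stack β G 1 = shift (β * (0 : ℕ)) G := by
    simp only [stack, Set.union_eq_left]
    rintro _ ⟨_, _, _, h, _⟩
    exact h.elim
  rwa [this]

/-- Entries `≥ β n` belong to the top block and smaller ones to the rest. Hence any extension of `s
++ t` splits at the same place, and the maximality of `s` and of `t` applies separately. -/
theorem append_mem_maxNodes_stack {β : Ordinal.{u}} {G : WTree.{u}} (hG : DecBelow β G) {n : ℕ}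
    {s t : List Ordinal.{u}} (hs : s ∈ maxNodes (shift (β * n) G))
    (ht : t ∈ maxNodes (stack β G n)) : s ++ t ∈ maxNodes (stack β G (n + 1)) := by
  obtain ⟨p, hp⟩ := mem_nodes.1 ht.1
  refine ⟨mem_nodes.2 ⟨p, Or.inr ⟨s, hs, _, hp, rfl⟩⟩, fun u hu hpre => ?_⟩
  obtain ⟨q, hq | ⟨s', hs', ⟨t', p'⟩, hp', e⟩⟩ := mem_nodes.1 hu
  · obtain ⟨⟨x, hx, -⟩, h3, -⟩ := stack_props hG n t ht.1
    exact absurd (h3 x hx) (not_lt.2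
      ((shift_props hG (β * n) u ⟨_, hq, rfl⟩).2.1 x (hpre.subset (by simp [hx]))).1)
  · simp only [Prod.mk.injEq] at e
    obtain ⟨rfl, rfl⟩ := e
    have : s' = s := hs.2 s' hs'.1 (prefix_of_append_prefix_append (fun x => β * n ≤ x)
      (fun x hx => ((shift_props hG (β * n) s hs.1).2.1 x hx).1)
      (fun x hx => ((shift_props hG (β * n) s' hs'.1).2.1 x hx).1)
      (fun x hx => not_le.2 ((stack_props hG n t' ⟨_, hp', rfl⟩).2.1 x hx)) hpre)
    subst this
    rw [ht.2 t' ⟨_, hp', rfl⟩ ((List.prefix_append_right_inj _).1 hpre)]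

/-- The first entry of a node is its largest and lies in `[ω ^ ζ (n - 1), ω ^ ζ n)`, so it
determines `n`. An extension has the same first entry and stays in the same `Γ_{ζ,n}`. -/
theorem mem_maxNodes_gammaOne_add_one {ζ : Ordinal.{u}} {n : ℕ} (hn : 1 ≤ n) {t : List Ordinal.{u}}
    (ht : t ∈ maxNodes (stack (ω ^ ζ) (gammaOne ζ) n)) : t ∈ maxNodes (gammaOne (ζ + 1)) := by
  have hD := (gammaOne_props ζ).1
  rw [gammaOne_add_one]
  obtain ⟨p, hp⟩ := mem_nodes.1 ht.1
  refine ⟨mem_nodes.2 ⟨_, n, hn, _, hp, rfl⟩, fun u hu hpre => ?_⟩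
  obtain ⟨q, m, hm, ⟨u', p'⟩, hp', e⟩ := mem_nodes.1 hu
  simp only [Prod.mk.injEq] at e
  obtain ⟨rfl, rfl⟩ := e
  obtain ⟨⟨x, hx, hx1⟩, hx2, -⟩ := stack_props hD n t ht.1
  obtain ⟨⟨y, hy, hy1⟩, hy2, hy3⟩ := stack_props hD m u ⟨_, hp', rfl⟩
  have key : ∀ {z : Ordinal.{u}} {i j : ℕ}, ω ^ ζ * ((i - 1 : ℕ) : Ordinal.{u}) ≤ z →
      z < ω ^ ζ * (j : Ordinal.{u}) → i ≤ j := by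
    intro z i j h1 h2
    have := lt_of_mul_lt_mul_left (h1.trans_lt h2) bot_le
    have : i - 1 < j := by exact_mod_cast this
    omega
  have h1 : n ≤ m := key hx1 (hy2 x (hpre.subset hx))
  have h2 : m ≤ n := by
    obtain ⟨a, t', rfl⟩ := List.exists_cons_of_ne_nil (List.ne_nil_of_mem hx)
    obtain ⟨w, rfl⟩ := hpre
    rw [List.cons_append, List.pairwise_cons] at hy3
    refine key (z := a) (hy1.trans ?_) (hx2 a (by simp))
    rw [List.cons_append, List.mem_cons] at hy
    rcases hy with rfl | hy
    · exact le_rfl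
    · exact (hy3.1 y hy).le
  obtain rfl : n = m := le_antisymm h1 h2
  exact ht.2 u ⟨_, hp', rfl⟩ hpre

/-- The branches of the union have entries in the disjoint intervals `[ω ^ ζ, ω ^ (ζ + 1))`, so an
extension cannot change `ζ`. -/
theorem mem_maxNodes_gammaOne_limit {ξ ζ : Ordinal.{u}} (hξ : Order.IsSuccLimit ξ) (hζ : ζ < ξ)
    {t : List Ordinal.{u}} (ht : t ∈ maxNodes (shift (ω ^ ζ) (gammaOne (ζ + 1)))) :
    t ∈ maxNodes (gammaOne ξ) := by
  rw [gammaOne_limit hξ]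
  obtain ⟨p, hp⟩ := mem_nodes.1 ht.1
  refine ⟨mem_nodes.2 ⟨_, ζ, hζ, hp⟩, fun u hu hpre => ?_⟩
  obtain ⟨q, ζ', hζ', hq⟩ := mem_nodes.1 hu
  have bd : ∀ ζ : Ordinal.{u}, ∀ t ∈ nodes (shift (ω ^ ζ) (gammaOne (ζ + 1))),
      t ≠ [] ∧ (∀ x ∈ t, ω ^ ζ ≤ x ∧ x < ω ^ (ζ + 1)) := by
    intro ζ t ht
    have := shift_props (gammaOne_props (ζ + 1)).1 (ω ^ ζ) t ht
    rw [omega0_opow_add_lt] at this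
    exact ⟨this.1, this.2.1⟩
  obtain ⟨x, hx⟩ := List.exists_mem_of_ne_nil t (bd ζ t ht.1).1
  have hx1 := (bd ζ t ht.1).2 x hx
  have hx2 := (bd ζ' u ⟨_, hq, rfl⟩).2 x (hpre.subset hx)
  have e : ζ = ζ' := by
    apply le_antisymm
    · exact Order.lt_add_one_iff.1
        ((Ordinal.opow_lt_opow_iff_right Ordinal.one_lt_omega0).1 (hx1.1.trans_lt hx2.2))
    · exact Order.lt_add_one_iff.1
        ((Ordinal.opow_lt_opow_iff_right Ordinal.one_lt_omega0).1 (hx2.1.trans_lt hx1.2))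
  subst e
  exact ht.2 u ⟨_, hq, rfl⟩ hpre

theorem infLevel_lt {ξ : Ordinal.{u}} {i : ℕ} {s : List Ordinal.{u}}
    (hs : s ∈ nodes (infLevel ξ i)) : ∀ x ∈ s, x < ω ^ ξ * ((i + 1 : ℕ) : Ordinal.{u}) := by
  obtain ⟨q, hq⟩ := mem_nodes.1 hs
  obtain ⟨s', v, e, hv, h⟩ := infLevel_eq ξ i hq
  simp only at e
  subst e
  intro x hx
  rw [mul_natCast_succ]
  rcases List.mem_append.1 hx with hx | hx
  · exact (h x hx).trans_le le_self_add
  · obtain ⟨y, hy, rfl⟩ := List.mem_map.1 hx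
    simpa using ((gammaOne_props ξ).1 v ⟨_, hv, rfl⟩).2.1 y hy

theorem append_mem_maxNodes_infLevel {ξ : Ordinal.{u}} {i : ℕ} {s t : List Ordinal.{u}}
    (hs : s ∈ maxNodes (infLevel ξ i)) (ht : t ∈ maxNodes (gammaOne ξ)) :
    s ++ shiftList (ω ^ ξ * ((i + 1 : ℕ) : Ordinal.{u})) t ∈ maxNodes (infLevel ξ (i + 1)) := by
  obtain ⟨p, hp⟩ := mem_nodes.1 ht.1
  refine ⟨mem_nodes.2 ⟨p, s, hs, _, hp, rfl⟩, fun u hu hpre => ?_⟩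
  obtain ⟨q, s', hs', ⟨t', p'⟩, hp', e⟩ := mem_nodes.1 hu
  simp only [Prod.mk.injEq] at e
  obtain ⟨rfl, rfl⟩ := e
  have : s' = s := hs.2 s' hs'.1 (prefix_of_append_prefix_append
    (fun x => x < ω ^ ξ * ((i + 1 : ℕ) : Ordinal.{u})) (infLevel_lt hs.1) (infLevel_lt hs'.1)
    (fun x hx => by
      obtain ⟨y, -, rfl⟩ := List.mem_map.1 hx
      exact not_lt.2 le_self_add) hpre)
  subst this
  rw [ht.2 t' ⟨_, hp', rfl⟩ ((List.prefix_map_iff_of_injective (fun a b e => by simpa using e)).1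
    ((List.prefix_append_right_inj _).1 hpre))]

/-! ### Closedness under initial segments, non-negativity of the weights -/

/-- The non-empty initial segments of the members of `T` belong to `T`. -/
def PrefixClosed {A : Type*} (T : Set (List A)) : Prop :=
  ∀ u ∈ T, ∀ t, t ≠ [] → t <+: u → t ∈ T

theorem PrefixClosed.shift {G : WTree.{u}} (hG : PrefixClosed (nodes G)) (ζ : Ordinal.{u}) :
    PrefixClosed (nodes (shift ζ G)) := by
  intro u hu t ht hpre
  obtain ⟨p, hp⟩ := mem_nodes.1 hu
  obtain ⟨u', hu', rfl⟩ := mem_shift.1 hp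
  obtain ⟨t', ht', rfl⟩ := List.prefix_map_iff.1 hpre
  obtain ⟨q, hq⟩ := mem_nodes.1 (hG u' ⟨_, hu', rfl⟩ t' (by rintro rfl; simp at ht) ht')
  exact mem_nodes.2 ⟨q, shiftList_mem_shift hq⟩

theorem PrefixClosed.stack {β : Ordinal.{u}} {G : WTree.{u}} (hG : PrefixClosed (nodes G)) (n : ℕ) :
    PrefixClosed (nodes (stack β G n)) := by
  induction n with
  | zero => rintro _ ⟨_, h, _⟩; exact h.elim
  | succ n ih =>
    intro u hu t ht hpre
    have hsh : ∀ u ∈ nodes (CKGame.shift (β * n) G), t <+: u →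
        t ∈ nodes (CKGame.stack β G (n + 1)) := by
      intro u hu hpre
      obtain ⟨p, hp⟩ := mem_nodes.1 (hG.shift (β * n) u hu t ht hpre)
      exact mem_nodes.2 ⟨p, Or.inl hp⟩
    obtain ⟨q, hq | ⟨s, hs, ⟨v, p⟩, hp, e⟩⟩ := mem_nodes.1 hu
    · exact hsh u ⟨_, hq, rfl⟩ hpre
    · simp only [Prod.mk.injEq] at e
      obtain ⟨rfl, rfl⟩ := e
      rcases List.prefix_or_prefix_of_prefix hpre (List.prefix_append s v) with h | ⟨v', rfl⟩
      · exact hsh s hs.1 h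
      · have hv' := (List.prefix_append_right_inj _).1 hpre
        by_cases hv : v' = []
        · subst hv
          exact hsh s hs.1 (by simp)
        · obtain ⟨p', hp'⟩ := mem_nodes.1 (ih v ⟨_, hp, rfl⟩ v' hv hv')
          exact mem_nodes.2 ⟨p', Or.inr ⟨s, hs, _, hp', rfl⟩⟩

theorem prefixClosed_gammaOne (ξ : Ordinal.{u}) : PrefixClosed (nodes (gammaOne ξ)) := by
  induction ξ using Ordinal.limitRecOn with
  | zero =>
    intro u hu t ht hpre
    simp only [gammaOne_zero, nodes, Set.image_singleton, Set.mem_singleton_iff] at hu ⊢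
    subst hu
    rcases List.prefix_cons_iff.1 hpre with h | ⟨v, rfl, hv⟩
    · exact (ht h).elim
    · rw [List.prefix_nil.1 hv]
  | add_one ζ ih =>
    intro u hu t ht hpre
    rw [gammaOne_add_one] at hu ⊢
    obtain ⟨q, n, hn, ⟨u', p⟩, hp, e⟩ := mem_nodes.1 hu
    simp only [Prod.mk.injEq] at e
    obtain ⟨rfl, rfl⟩ := e
    obtain ⟨p', hp'⟩ := mem_nodes.1 (ih.stack n u ⟨_, hp, rfl⟩ t ht hpre)
    exact mem_nodes.2 ⟨_, n, hn, _, hp', rfl⟩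
  | limit ξ hξ ih =>
    intro u hu t ht hpre
    rw [gammaOne_limit hξ] at hu ⊢
    obtain ⟨q, ζ, hζ, hq⟩ := mem_nodes.1 hu
    obtain ⟨p', hp'⟩ := mem_nodes.1
      ((ih _ (hξ.add_one_lt hζ)).shift (ω ^ ζ) u ⟨_, hq, rfl⟩ t ht hpre)
    exact mem_nodes.2 ⟨p', ζ, hζ, hp'⟩

theorem mem_nodes_gammaInf {ξ : Ordinal.{u}} {t : List Ordinal.{u}} :
    t ∈ nodes (gammaInf ξ) ↔ ∃ i, t ∈ nodes (infLevel ξ i) := by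
  simp only [mem_nodes, gammaInf, Set.mem_iUnion]
  exact exists_comm

/-- Ensures that Player S has a legal move at a node that is not maximal in its level: the next
entry of a longer node. -/
theorem prefixClosed_gammaInf (ξ : Ordinal.{u}) : PrefixClosed (nodes (gammaInf ξ)) := by
  intro u hu t ht hpre
  obtain ⟨i, hi⟩ := mem_nodes_gammaInf.1 hu
  induction i generalizing u with
  | zero => exact mem_nodes_gammaInf.2 ⟨0, prefixClosed_gammaOne ξ u hi t ht hpre⟩
  | succ i ih =>
    obtain ⟨q, s, hs, ⟨v, p⟩, hp, e⟩ := mem_nodes.1 hi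
    simp only [Prod.mk.injEq] at e
    obtain ⟨rfl, rfl⟩ := e
    have hsn := mem_nodes_gammaInf.2 ⟨i, hs.1⟩
    rcases List.prefix_or_prefix_of_prefix hpre (List.prefix_append s _) with h | ⟨w, rfl⟩
    · exact ih s hsn h hs.1
    · obtain ⟨v', hv', rfl⟩ :=
        List.prefix_map_iff.1 ((List.prefix_append_right_inj _).1 hpre)
      by_cases hv : v' = []
      · subst hv
        simpa using hsn
      · obtain ⟨p', hp'⟩ := mem_nodes.1 (prefixClosed_gammaOne ξ v ⟨_, hp, rfl⟩ v' hv hv')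
        exact mem_nodes_gammaInf.2 ⟨i + 1, mem_nodes.2 ⟨p', s, hs, _, hp', rfl⟩⟩

theorem stack_nonneg {β : Ordinal.{u}} {G : WTree.{u}} (hG : ∀ q ∈ G, 0 ≤ q.2) (n : ℕ) :
    ∀ q ∈ stack β G n, 0 ≤ q.2 := by
  induction n with
  | zero => intro q h; exact h.elim
  | succ n ih =>
    rintro _ (⟨q, hq, rfl⟩ | ⟨s, -, q, hq, rfl⟩)
    · exact hG q hq
    · exact ih q hq

theorem gammaOne_nonneg (ξ : Ordinal.{u}) : ∀ q ∈ gammaOne ξ, 0 ≤ q.2 := by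
  induction ξ using Ordinal.limitRecOn with
  | zero => simp [gammaOne_zero]
  | add_one ζ ih =>
    rw [gammaOne_add_one]
    rintro _ ⟨n, -, q, hq, rfl⟩
    exact mul_nonneg (by positivity) (stack_nonneg ih n q hq)
  | limit ξ hξ ih =>
    rw [gammaOne_limit hξ]
    rintro _ ⟨ζ, hζ, q, hq, rfl⟩
    exact ih _ (hξ.add_one_lt hζ) q hq

theorem gammaInf_nonneg (ξ : Ordinal.{u}) : ∀ q ∈ gammaInf ξ, 0 ≤ q.2 := by
  intro q hq
  obtain ⟨i, hi⟩ := Set.mem_iUnion.1 hq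
  obtain ⟨_, v, _, h, _⟩ := infLevel_eq ξ i hi
  exact gammaOne_nonneg ξ (v, q.2) h

/-! ### Forcing the end of a well-founded tree

In the simplified game Player V answers with a single continuous function `g : Ω → [0, 1]`
vanishing on `N`. -/

section Force

variable {Ω : Type u} [TopologicalSpace Ω]

/-- Player V may answer `g` to `N`. -/
def IsAnswer (N : Set Ω) (g : C(Ω, ℝ)) : Prop := (∀ x, 0 ≤ g x ∧ g x ≤ 1) ∧ ∀ x ∈ N, g x = 0

/-- From the node `t` of `G` (or from the root `[]`), the weighted sum of the answers so far
being `h`, Player S can force that a maximal node of `G` is reached at which the weighted sum of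
the answers satisfies `Φ`. -/
inductive Force (G : WTree.{u}) (Φ : C(Ω, ℝ) → Prop) : List Ordinal.{u} → C(Ω, ℝ) → Prop
  | done (t : List Ordinal.{u}) (h : C(Ω, ℝ)) (ht : t ∈ maxNodes G) (hh : Φ h) : Force G Φ t h
  | step (t : List Ordinal.{u}) (h : C(Ω, ℝ)) (ζ : Ordinal.{u}) (p : ℝ) (N : Set Ω)
      (hp : (t ++ [ζ], p) ∈ G) (hN : N.Finite)
      (hg : ∀ g, IsAnswer N g → Force G Φ (t ++ [ζ]) (h + p • g)) : Force G Φ t h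

theorem isAnswer_zero (N : Set Ω) : IsAnswer N (0 : C(Ω, ℝ)) := by
  simp [IsAnswer]

variable {G G' : WTree.{u}} {Φ Ψ : C(Ω, ℝ) → Prop} {t : List Ordinal.{u}} {h : C(Ω, ℝ)}

/-- Player V can answer by `0` all the time. -/
theorem Force.prop (H : Force G Φ t h) : Φ h := by
  induction H with
  | done t h ht hh => exact hh
  | step t h ζ p N hp hN hg ih => simpa using ih 0 (isAnswer_zero N)

/-- Transfers play on `G` to a copy of `G` inside `G'`, placed after `s`, shifted by `ζ` and with
weights multiplied by `c`. When the copy is exhausted, `hdone` takes over, so forcing arguments can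
be concatenated. -/
theorem Force.bind {s : List Ordinal.{u}} {ζ : Ordinal.{u}} {c : ℝ} {T : C(Ω, ℝ)}
    (hstep : ∀ t p, (t, p) ∈ G → (s ++ shiftList ζ t, c * p) ∈ G')
    (hdone : ∀ t ∈ maxNodes G, ∀ h, Φ h → Force G' Ψ (s ++ shiftList ζ t) (T + c • h))
    (H : Force G Φ t h) : Force G' Ψ (s ++ shiftList ζ t) (T + c • h) := by
  induction H with
  | done t h ht hh => exact hdone t ht h hh
  | step t h ζ' p N hp hN hg ih =>
    have e : s ++ shiftList ζ (t ++ [ζ']) = (s ++ shiftList ζ t) ++ [ζ + ζ'] := by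
      simp [shiftList]
    refine Force.step _ _ (ζ + ζ') (c * p) N (e ▸ hstep _ _ hp) hN fun g hg' => ?_
    have := ih g hg'
    rwa [e, smul_add, smul_smul, ← add_assoc] at this

theorem shiftList_zero (t : List Ordinal.{u}) : shiftList 0 t = t := by
  simp [shiftList]

theorem Force.mono (hΦ : ∀ h, Φ h → Ψ h) (H : Force G Φ t h) : Force G Ψ t h := by
  induction H with
  | done t h ht hh => exact .done t h ht (hΦ h hh)
  | step t h ζ p N hp hN hg ih => exact .step t h ζ p N hp hN ih

/-! ### The rank condition on the accumulated sums -/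

/-- The sum `T` of the answers exceeds `j - 1 + δ` only on a subset of `K` of small rank. -/
def RankBound (K : Set Ω) (β : Ordinal.{u}) (r : ℕ) (δ : ℝ) (T : C(Ω, ℝ)) : Prop :=
  ∀ j ≤ r, iteratedDerivedSet {x | x ∈ K ∧ (j : ℝ) - 1 + δ ≤ T x}
    (β * ((r - j : ℕ) : Ordinal.{u})) = ∅

theorem isClosed_inter_ge {K : Set Ω} (hK : IsClosed K) (T : C(Ω, ℝ)) (a : ℝ) :
    IsClosed {x | x ∈ K ∧ a ≤ T x} :=
  hK.inter (isClosed_le continuous_const T.continuous)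

theorem RankBound.lt {K : Set Ω} {β : Ordinal.{u}} {r : ℕ} {δ : ℝ} {T : C(Ω, ℝ)}
    (H : RankBound K β r δ T) : ∀ x ∈ K, T x < r - 1 + δ := by
  intro x hx
  by_contra hcon
  have := H r le_rfl
  rw [Nat.sub_self, Nat.cast_zero, mul_zero, iteratedDerivedSet_zero] at this
  exact Set.notMem_empty x (this ▸ ⟨hx, not_lt.1 hcon⟩)

theorem iteratedDerivedSet_eq_empty_of_subset {s t : Set Ω} (h : s ⊆ t) {a : Ordinal.{u}}
    (ht : iteratedDerivedSet t a = ∅) : iteratedDerivedSet s a = ∅ :=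
  Set.subset_empty_iff.1 ((iteratedDerivedSet_mono_right h a).trans ht.subset)

/-- For `j = 0` the condition follows from the rank of `K`; for `j ≥ 1` the threshold `j - 1 + δ` is
positive and the set is empty. -/
theorem rankBound_zero {K : Set Ω} {β : Ordinal.{u}} {r : ℕ}
    (hK : iteratedDerivedSet K (β * (r : Ordinal.{u})) = ∅) {δ : ℝ} (hδ : 0 < δ) :
    RankBound K β r δ 0 := by
  intro j hj
  rcases Nat.eq_zero_or_pos j with rfl | hj'
  · exact iteratedDerivedSet_eq_empty_of_subset (fun x hx => hx.1) (by simpa using hK)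
  · refine iteratedDerivedSet_eq_empty_of_subset (t := ∅) (fun x hx => ?_)
      (Set.subset_empty_iff.1 (iteratedDerivedSet_subset _ _))
    have h1 : (1 : ℝ) ≤ j := by exact_mod_cast hj'
    have h2 := hx.2
    simp only [ContinuousMap.zero_apply] at h2
    exact absurd h2 (by linarith)

/-- The condition on the sum `h` of the answers in one level that Player S aims at. -/
def SmallOn (L : Set Ω) (ε : ℝ) (h : C(Ω, ℝ)) : Prop := (∀ x ∈ L, h x < ε) ∧ ∀ x, h x ≤ 1

/-- The set on which the answers in the next level have to be small. -/
def criticalSet (K : Set Ω) (β : Ordinal.{u}) (r : ℕ) (δ : ℝ) (T : C(Ω, ℝ)) : Set Ω :=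
  ⋃ j < r, iteratedDerivedSet {x | x ∈ K ∧ (j : ℝ) - 1 + δ ≤ T x}
    (β * ((r - 1 - j : ℕ) : Ordinal.{u}))

theorem isClosed_criticalSet {K : Set Ω} (hK : IsClosed K) (β : Ordinal.{u}) (r : ℕ) (δ : ℝ)
    (T : C(Ω, ℝ)) : IsClosed (criticalSet K β r δ T) :=
  (Set.finite_lt_nat r).isClosed_biUnion fun _ _ =>
    isClosed_iteratedDerivedSet (isClosed_inter_ge hK T _) _

/-- A further `β` derivatives turn the order `β (r - 1 - j)` of the `j`-th piece into `β (r - j)`,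
where the rank bound makes it empty. -/
theorem iteratedDerivedSet_criticalSet {K : Set Ω} (hK : IsClosed K) {β : Ordinal.{u}} {r : ℕ}
    {δ : ℝ} {T : C(Ω, ℝ)} (H : RankBound K β r δ T) :
    iteratedDerivedSet (criticalSet K β r δ T) β = ∅ := by
  refine iteratedDerivedSet_biUnion_eq_empty r
    (fun j _ => isClosed_iteratedDerivedSet (isClosed_inter_ge hK T _) _) fun j hj => ?_
  rw [iteratedDerivedSet_add, ← mul_natCast_succ, show r - 1 - j + 1 = r - j by omega]
  exact H j hj.le

/-- At a point where `T + h ≥ j + δ + ε`, either `h < ε` and already `T ≥ j + δ`, or `h ≥ ε` and,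
since `h ≤ 1`, at least `T ≥ j - 1 + δ`. Points of the second kind lie in a closed set whose
derivative of order `β (r - j - 1)` is contained in the critical set, where `h < ε`; so that
derivative is empty. -/
theorem RankBound.add {K : Set Ω} (hK : IsClosed K) {β : Ordinal.{u}} {r : ℕ}
    (hKr : iteratedDerivedSet K (β * (r : Ordinal.{u})) = ∅) {δ ε : ℝ} (hε : 0 ≤ ε)
    {T h : C(Ω, ℝ)} (H : RankBound K β r δ T)
    (hh : SmallOn (criticalSet K β r δ T) ε h) : RankBound K β r (δ + ε) (T + h) := by
  intro j hj
  rcases Nat.eq_zero_or_pos j with rfl | hj'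
  · exact iteratedDerivedSet_eq_empty_of_subset (fun x hx => hx.1) (by simpa using hKr)
  obtain ⟨j, rfl⟩ : ∃ i, j = i + 1 := ⟨j - 1, by omega⟩
  set M : Set Ω := {x | x ∈ K ∧ (j : ℝ) - 1 + δ ≤ T x} ∩ {x | ε ≤ h x} with hM
  have hMc : IsClosed M :=
    (isClosed_inter_ge hK T _).inter (isClosed_le continuous_const h.continuous)
  have hMe : iteratedDerivedSet M (β * ((r - (j + 1) : ℕ) : Ordinal.{u})) = ∅ := by
    rw [Set.eq_empty_iff_forall_notMem]
    intro x hx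
    have h1 : x ∈ criticalSet K β r δ T := by
      refine Set.mem_biUnion (show j < r by omega) ?_
      rw [show r - 1 - j = r - (j + 1) by omega]
      exact iteratedDerivedSet_mono_right Set.inter_subset_left _ hx
    exact absurd (hh.1 x h1) (not_lt.2 (iteratedDerivedSet_subset _ _ hx).2)
  refine iteratedDerivedSet_eq_empty_of_subset
    (t := {x | x ∈ K ∧ ((j + 1 : ℕ) : ℝ) - 1 + δ ≤ T x} ∪ M) (fun x hx => ?_) ?_
  · obtain ⟨hxK, hx⟩ := hx
    rw [ContinuousMap.add_apply] at hx
    by_cases hM' : ε ≤ h x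
    · refine Or.inr ⟨⟨hxK, ?_⟩, hM'⟩
      have := hh.2 x
      push_cast at hx
      linarith
    · exact Or.inl ⟨hxK, by linarith⟩
  · refine Set.subset_empty_iff.1 ((iteratedDerivedSet_union_subset (isClosed_inter_ge hK T _)
      hMc _).trans ?_)
    rw [hMe, H _ hj, Set.union_empty]

/-! ### Forcing small sums on one level, by induction on the exponent -/

theorem Force.append {s : List Ordinal.{u}} {ζ : Ordinal.{u}} {T : C(Ω, ℝ)}
    (hstep : ∀ t p, (t, p) ∈ G → (s ++ shiftList ζ t, p) ∈ G')
    (hdone : ∀ t ∈ maxNodes G, ∀ h, Φ h → Force G' Ψ (s ++ shiftList ζ t) (T + h))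
    (H : Force G Φ [] 0) : Force G' Ψ s T := by
  have := Force.bind (s := s) (ζ := ζ) (c := 1) (T := T) (G' := G') (Ψ := Ψ)
    (by simpa using hstep) (by simpa using hdone) H
  simpa [shiftList] using this

variable (Ω) in
/-- On `G`, Player S can make the sum of the answers small on any given closed set `L` with
empty `β`-th derivative. -/
def IsForcible (β : Ordinal.{u}) (G : WTree.{u}) : Prop :=
  ∀ L : Set Ω, IsClosed L → iteratedDerivedSet L β = ∅ → ∀ ε : ℝ, 0 < ε →
    Force G (SmallOn L ε) [] 0

theorem IsForcible.force_add {β : Ordinal.{u}} (hG : IsForcible Ω β G) {K : Set Ω}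
    (hK : IsClosed K) {r : ℕ} (hKr : iteratedDerivedSet K (β * (r : Ordinal.{u})) = ∅)
    {δ δ' : ℝ} (hδ : δ < δ') {T : C(Ω, ℝ)} (H : RankBound K β r δ T) :
    Force G (fun h => RankBound K β r δ' (T + h) ∧ ∀ x, h x ≤ 1) [] 0 := by
  refine (hG _ (isClosed_criticalSet hK β r δ T) (iteratedDerivedSet_criticalSet hK H) (δ' - δ)
    (sub_pos.2 hδ)).mono fun h hh => ⟨?_, hh.2⟩
  simpa using H.add hK hKr (sub_pos.2 hδ).le hh

/-- Each block raises the upper bound of the sum by at most `1` while `δ` grows only within `[δ,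
δ']`. On `K` the bound on the sum therefore does not depend on the number of blocks. -/
theorem IsForcible.force_stack {β : Ordinal.{u}} (hG : IsForcible Ω β G) (hD : DecBelow β G)
    {K : Set Ω} (hK : IsClosed K) {r : ℕ}
    (hKr : iteratedDerivedSet K (β * (r : Ordinal.{u})) = ∅) (n : ℕ) {δ δ' c : ℝ} (hδ : δ < δ')
    {T : C(Ω, ℝ)} (H : RankBound K β r δ T) (hT : ∀ x, T x ≤ c) :
    Force (stack β G (n + 1)) (fun h => RankBound K β r δ' h ∧ ∀ x, h x ≤ c + (n + 1 : ℕ)) [] T := by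
  induction n generalizing δ c T with
  | zero =>
    refine Force.append (ζ := β * (0 : ℕ)) (fun t p hp => Or.inl (shiftList_mem_shift hp))
      (fun t ht h hh => ?_) (hG.force_add hK hKr hδ H)
    refine .done _ _ (mem_maxNodes_stack_one (shiftList_mem_maxNodes_shift ht)) ⟨hh.1, fun x => ?_⟩
    have h1 := hh.2 x
    have h2 := hT x
    push_cast
    change T x + h x ≤ _
    linarith
  | succ n ih =>
    obtain ⟨δ₁, h1, h2⟩ := exists_between hδ
    refine Force.append (ζ := β * (n + 1 : ℕ)) (fun t p hp => Or.inl (shiftList_mem_shift hp))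
      (fun t ht h hh => ?_) (hG.force_add hK hKr h1 H)
    have hs := shiftList_mem_maxNodes_shift (ζ := β * (n + 1 : ℕ)) ht
    have hTh : ∀ x, (T + h) x ≤ c + 1 := fun x => add_le_add (hT x) (hh.2 x)
    -- The remaining blocks already sit at their place below `β (n + 1)`, hence the shift `0`; the
    -- induction hypothesis starts from `T + h`, so nothing is added to the sum.
    have := Force.bind (s := shiftList (β * (n + 1 : ℕ)) t) (ζ := 0) (c := 1) (T := 0)
      (G' := stack β G (n + 1 + 1))
      (Ψ := fun h => RankBound K β r δ' h ∧ ∀ x, h x ≤ c + (n + 1 + 1 : ℕ))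
      (fun t' p hp => Or.inr ⟨_, hs, _, hp, by simp [shiftList_zero]⟩)
      (fun t' ht' h' hh' => .done _ _
        (by simpa [shiftList_zero] using append_mem_maxNodes_stack hD hs ht')
        ⟨by simpa using hh'.1, fun x => ?_⟩) (ih h2 hh.1 hTh)
    · simpa [shiftList] using this
    · have := hh'.2 x
      push_cast at this ⊢
      simp only [zero_add, one_smul]
      linarith

variable (Ω) in
-- The rank bound is used here with `K = L`, one exponent lower than in the infinite game. On `L`
-- the sum over `n + 1` blocks stays below some `r` independent of `n`, elsewhere it is at most `n +
-- 1`; the weights of `Γ_{ξ+1,1}` divide it by `n + 1`.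
theorem isForcible_gammaOne [CompactSpace Ω] (ξ : Ordinal.{u}) :
    IsForcible Ω (ω ^ ξ) (gammaOne ξ) := by
  induction ξ using Ordinal.limitRecOn with
  | zero =>
    intro L hL hLe ε hε
    rw [opow_zero] at hLe
    refine .step [] 0 0 1 L (by simp [gammaOne_zero])
      (finite_of_iteratedDerivedSet_one_eq_empty hL hLe) fun g hg => ?_
    refine .done _ _ ?_ ⟨fun x hx => ?_, fun x => ?_⟩
    · simp [gammaOne_zero, maxNodes, nodes]
    · simpa [hg.2 x hx] using hε
    · simpa using (hg.1 x).2
  | add_one ξ ih =>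
    intro L hL hLe ε hε
    have hlim : Order.IsSuccLimit (ω ^ (ξ + 1)) :=
      Ordinal.isSuccLimit_opow_left Ordinal.isSuccLimit_omega0 (by simp)
    obtain ⟨b, hb, hLb⟩ := exists_iteratedDerivedSet_eq_empty hL hlim hLe
    rw [opow_add, opow_one, Ordinal.lt_mul_iff_of_isSuccLimit Ordinal.isSuccLimit_omega0] at hb
    obtain ⟨_, hr, hb⟩ := hb
    obtain ⟨r, rfl⟩ := Ordinal.lt_omega0.1 hr
    have hLr : iteratedDerivedSet L (ω ^ ξ * (r : Ordinal.{u})) = ∅ :=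
      Set.subset_empty_iff.1 (hLb ▸ iteratedDerivedSet_antitone L hb.le)
    obtain ⟨n, hn⟩ := exists_nat_gt (r / ε)
    have hn' : (r : ℝ) < ε * (n + 1 : ℕ) := by
      rw [div_lt_iff₀ hε] at hn
      push_cast
      linarith
    -- Ending at `δ' = 1` gives exactly the bound `r - 1 + 1 = r` on `L`.
    have H := ih.force_stack (gammaOne_props ξ).1 hL hLr n (δ := 1 / 2) (δ' := 1) (c := 0)
      (by norm_num) (rankBound_zero hLr (by norm_num)) (by simp)
    have := Force.bind (s := []) (ζ := 0) (c := 1 / (n + 1 : ℕ)) (T := 0)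
      (G' := gammaOne (ξ + 1)) (Ψ := SmallOn L ε)
      (fun t p hp => by
        rw [gammaOne_add_one]
        exact ⟨n + 1, by omega, _, hp, by simp [shiftList_zero]⟩)
      (fun t ht h hh => .done _ _
        (by simpa [shiftList_zero] using mem_maxNodes_gammaOne_add_one (by omega) ht)
        ⟨fun x hx => ?_, fun x => ?_⟩) H
    · simpa [shiftList] using this
    · have h1 := hh.1.lt x hx
      have h2 : (0 : ℝ) < (n + 1 : ℕ) := by positivity
      rw [zero_add, ContinuousMap.smul_apply, _root_.smul_eq_mul, one_div_mul_eq_div, div_lt_iff₀ h2]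
      linarith
    · have h1 := hh.2 x
      have h2 : (0 : ℝ) < (n + 1 : ℕ) := by positivity
      rw [zero_add, ContinuousMap.smul_apply, _root_.smul_eq_mul, one_div_mul_eq_div, div_le_iff₀ h2]
      linarith
  | limit ξ hξ ih =>
    intro L hL hLe ε hε
    have hlim : Order.IsSuccLimit (ω ^ ξ) :=
      Ordinal.isSuccLimit_opow_left Ordinal.isSuccLimit_omega0 hξ.ne_bot
    obtain ⟨b, hb, hLb⟩ := exists_iteratedDerivedSet_eq_empty hL hlim hLe
    obtain ⟨ζ, hζ, hb⟩ := (Ordinal.lt_opow_of_isSuccLimit Ordinal.omega0_ne_zero hξ).1 hb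
    have hb' : b ≤ ω ^ (ζ + 1) :=
      hb.le.trans (Ordinal.opow_le_opow_right Ordinal.omega0_pos (lt_add_one ζ).le)
    have hLζ : iteratedDerivedSet L (ω ^ (ζ + 1)) = ∅ :=
      Set.subset_empty_iff.1 (hLb ▸ iteratedDerivedSet_antitone L hb')
    refine Force.append (ζ := ω ^ ζ) (fun t p hp => ?_) (fun t ht h hh => ?_)
      (ih _ (hξ.add_one_lt hζ) L hL hLζ ε hε)
    · rw [gammaOne_limit hξ]
      exact ⟨ζ, hζ, shiftList_mem_shift hp⟩
    · exact .done _ _ (mem_maxNodes_gammaOne_limit hξ hζ (shiftList_mem_maxNodes_shift ht))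
        (by simpa using hh)

end Force

/-! ### The infinite game -/

theorem exists_append_mem_gammaInf {ξ x : Ordinal.{u}} {t : List Ordinal.{u}}
    (hx : [x] ∈ nodes (gammaOne ξ)) (ha : t = [] ∨ t ∈ nodes (gammaInf ξ)) :
    ∃ ζ, t ++ [ζ] ∈ nodes (gammaInf ξ) := by
  rcases ha with rfl | ht
  · exact ⟨x, mem_nodes_gammaInf.2 ⟨0, hx⟩⟩
  obtain ⟨i, hi⟩ := mem_nodes_gammaInf.1 ht
  by_cases hmax : t ∈ maxNodes (infLevel ξ i)
  · obtain ⟨p, hp⟩ := mem_nodes.1 hx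
    exact ⟨ω ^ ξ * ((i + 1 : ℕ) : Ordinal.{u}) + x,
      mem_nodes_gammaInf.2 ⟨i + 1, mem_nodes.2 ⟨p, t, hmax, _, hp, by simp [shiftList]⟩⟩⟩
  · have : ∃ u ∈ nodes (infLevel ξ i), t <+: u ∧ u ≠ t := by
      by_contra! hcon
      exact hmax ⟨hi, hcon⟩
    obtain ⟨_, hu, ⟨v, rfl⟩, hne⟩ := this
    obtain ⟨ζ, v, rfl⟩ := List.exists_cons_of_ne_nil (l := v) (by rintro rfl; simp at hne)
    exact ⟨ζ, prefixClosed_gammaInf ξ _ (mem_nodes_gammaInf.2 ⟨i, hu⟩) _ (by simp)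
      ⟨v, by simp⟩⟩

theorem weight_nonneg (ξ : Ordinal.{u}) (t : List Ordinal.{u}) : 0 ≤ weight (gammaInf ξ) t := by
  rw [weight]
  split_ifs with h
  · exact gammaInf_nonneg ξ _ h.choose_spec
  · exact le_rfl

theorem initSeg_succ {A : Type*} (τ : ℕ → A) (n : ℕ) :
    initSeg τ (n + 1) = initSeg τ n ++ [τ n] := by
  simp [initSeg, List.range_succ]

theorem map_initSeg {A B : Type*} (f : A → B) (τ : ℕ → A) (n : ℕ) :
    (initSeg τ n).map f = initSeg (fun k => f (τ k)) n := by
  simp [initSeg, Function.comp_def]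

theorem take_initSeg {A : Type*} (τ : ℕ → A) {k n : ℕ} (h : k ≤ n) :
    (initSeg τ n).take k = initSeg τ k := by
  rw [initSeg, ← List.map_take, List.take_range, min_eq_left h, initSeg]

section Game

variable {Ω : Type u} [TopologicalSpace Ω]

variable {𝕜 : Type*} [RCLike 𝕜]

/-- The function `h` dominates the weighted sums over the finite play `a`. -/
def Dominates (ξ : Ordinal.{u}) (a : List (Ordinal.{u} × Set C(Ω, 𝕜))) (h : C(Ω, ℝ)) : Prop :=
  ∀ f : ℕ → C(Ω, 𝕜), (∀ k (hk : k < a.length), f k ∈ a[k].2) → ∀ x,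
    ∑ k ∈ Finset.range a.length,
      weight (gammaInf ξ) ((a.map Prod.fst).take (k + 1)) * ‖f k x‖ ≤ h x

theorem Dominates.append {ξ : Ordinal.{u}} {a : List (Ordinal.{u} × Set C(Ω, 𝕜))} {h g : C(Ω, ℝ)}
    (H : Dominates ξ a h) {ζ : Ordinal.{u}} {p : ℝ}
    (hp : (a.map Prod.fst ++ [ζ], p) ∈ gammaInf ξ) {F : Set C(Ω, 𝕜)}
    (hg : ∀ f ∈ F, ∀ x, ‖f x‖ ≤ g x) : Dominates ξ (a ++ [(ζ, F)]) (h + p • g) := by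
  intro f hf x
  have h1 : ∑ k ∈ Finset.range a.length,
      weight (gammaInf ξ) (((a ++ [(ζ, F)]).map Prod.fst).take (k + 1)) * ‖f k x‖ ≤ h x := by
    refine le_trans (le_of_eq (Finset.sum_congr rfl fun k hk => ?_)) (H f (fun k hk => ?_) x)
    · rw [List.map_append, List.take_append_of_le_length]
      simpa using Finset.mem_range.1 hk
    · have := hf k (by simp; omega)
      rwa [List.getElem_append_left hk] at this
  have h2 : ‖f a.length x‖ ≤ g x := by
    refine hg _ ?_ x
    simpa using hf a.length (by simp)
  rw [List.length_append, List.length_singleton, Finset.sum_range_succ]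
  refine add_le_add h1 ?_
  rw [List.take_of_length_le (by simp), List.map_append, List.map_singleton,
    weight_eq (functional_gammaInf ξ) hp]
  exact mul_le_mul_of_nonneg_left h2 (gammaInf_nonneg ξ _ hp)

/-- The finite plays `a` that are good for Player S. -/
def IsGood (ξ : Ordinal.{u}) (r : ℕ) (a : List (Ordinal.{u} × Set C(Ω, 𝕜))) : Prop :=
  ∃ (i : ℕ) (δ : ℝ) (h : C(Ω, ℝ)), δ < 1 ∧
    Force (infLevel ξ i) (RankBound (Set.univ : Set Ω) (ω ^ ξ) r δ) (a.map Prod.fst) h ∧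
    Dominates ξ a h

/-- By `Force.prop` the rank bound holds at every moment of the play and not only at the ends of
levels. -/
theorem IsGood.sum_le {ξ : Ordinal.{u}} {r : ℕ} {α : ℕ → Ordinal.{u} × Set C(Ω, 𝕜)} {n : ℕ}
    (H : IsGood ξ r (initSeg α n)) {f : ℕ → C(Ω, 𝕜)} (hf : ∀ k, f k ∈ (α k).2) (x : Ω) :
    ∑ k ∈ Finset.range n, weight (gammaInf ξ) (initSeg (fun k => (α k).1) (k + 1)) * ‖f k x‖ ≤
      r := by
  obtain ⟨i, δ, h, hδ, HF, hdom⟩ := H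
  have h1 := hdom f (fun k hk => by simpa [initSeg] using hf k) x
  have h2 := HF.prop.lt x (Set.mem_univ x)
  have h3 : (initSeg α n).length = n := by simp [initSeg]
  rw [h3] at h1
  refine le_trans (le_of_eq (Finset.sum_congr rfl fun k hk => ?_)) (h1.trans (by linarith))
  rw [map_initSeg, take_initSeg _ (Nat.succ_le_of_lt (Finset.mem_range.1 hk))]

/-! ### Passing from one level to the next -/

variable [CompactSpace Ω]

theorem force_infLevel_zero (ξ : Ordinal.{u}) {r : ℕ}
    (hr : iteratedDerivedSet (Set.univ : Set Ω) (ω ^ ξ * (r : Ordinal.{u})) = ∅) {δ : ℝ}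
    (hδ : 0 < δ) : Force (infLevel ξ 0) (RankBound (Set.univ : Set Ω) (ω ^ ξ) r δ) [] 0 := by
  obtain ⟨δ', h1, h2⟩ := exists_between hδ
  exact ((isForcible_gammaOne Ω ξ).force_add isClosed_univ hr h2 (rankBound_zero hr h1)).mono
    fun h hh => by simpa using hh.1

theorem force_infLevel_succ {ξ : Ordinal.{u}} {r : ℕ}
    (hr : iteratedDerivedSet (Set.univ : Set Ω) (ω ^ ξ * (r : Ordinal.{u})) = ∅) {δ δ' : ℝ}
    (hδ : δ < δ') {T : C(Ω, ℝ)} (hT : RankBound (Set.univ : Set Ω) (ω ^ ξ) r δ T) {i : ℕ}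
    {s : List Ordinal.{u}} (hs : s ∈ maxNodes (infLevel ξ i)) :
    Force (infLevel ξ (i + 1)) (RankBound (Set.univ : Set Ω) (ω ^ ξ) r δ') s T :=
  Force.append (ζ := ω ^ ξ * ((i + 1 : ℕ) : Ordinal.{u})) (fun _ _ hp => ⟨s, hs, _, hp, rfl⟩)
    (fun _ ht _ hh => .done _ _ (append_mem_maxNodes_infLevel hs ht) hh.1)
    ((isForcible_gammaOne Ω ξ).force_add isClosed_univ hr hδ hT)

/-- Every legal answer to `an N` is dominated by a single function. -/
theorem exists_isAnswer {N : Set Ω} {F : Set C(Ω, 𝕜)} (hF : F ∈ finiteBallSets 𝕜 Ω)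
    (hN : F ⊆ an 𝕜 Ω N) : ∃ g : C(Ω, ℝ), IsAnswer N g ∧ ∀ f ∈ F, ∀ x, ‖f x‖ ≤ g x := by
  obtain ⟨hfin, ⟨f₀, hf₀⟩, hball⟩ := hF
  have hne : hfin.toFinset.Nonempty := ⟨f₀, by simpa using hf₀⟩
  have hle : ∀ f ∈ F, ∀ x, ‖f x‖ ≤ 1 := fun f hf x =>
    (f.norm_coe_le_norm x).trans (by simpa using hball hf)
  refine ⟨hfin.toFinset.sup' hne absFun, ⟨fun x => ⟨?_, ?_⟩, fun x hx => ?_⟩, fun f hf x => ?_⟩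
  · rw [ContinuousMap.sup'_apply]
    exact (norm_nonneg (f₀ x)).trans
      (Finset.le_sup' (fun f : C(Ω, 𝕜) => absFun f x) (by simpa using hf₀))
  · rw [ContinuousMap.sup'_apply]
    exact Finset.sup'_le _ _ fun f hf => hle f (by simpa using hf) x
  · rw [ContinuousMap.sup'_apply]
    refine le_antisymm (Finset.sup'_le _ _ fun f hf => ?_) ?_
    · have : f x = 0 := hN (by simpa using hf) x hx
      simp [absFun, this]
    · exact (norm_nonneg (f₀ x)).trans
        (Finset.le_sup' (fun f : C(Ω, 𝕜) => absFun f x) (by simpa using hf₀))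
  · rw [ContinuousMap.sup'_apply]
    exact Finset.le_sup' (fun f : C(Ω, 𝕜) => absFun f x) (by simpa using hf)

theorem isGood_nil {ξ : Ordinal.{u}} {r : ℕ}
    (hr : iteratedDerivedSet (Set.univ : Set Ω) (ω ^ ξ * (r : Ordinal.{u})) = ∅) :
    IsGood ξ r ([] : List (Ordinal.{u} × Set C(Ω, 𝕜))) :=
  ⟨0, 1 / 2, 0, by norm_num, force_infLevel_zero ξ hr (by norm_num), fun f _ x => by simp⟩

/-- A good play that is in the middle of a level, or at its end, can be continued. -/
theorem IsGood.exists_step {ξ : Ordinal.{u}} {r : ℕ}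
    (hr : iteratedDerivedSet (Set.univ : Set Ω) (ω ^ ξ * (r : Ordinal.{u})) = ∅)
    {a : List (Ordinal.{u} × Set C(Ω, 𝕜))} (ha : IsGood ξ r a) :
    ∃ (ζ : Ordinal.{u}) (N : Set Ω), N.Finite ∧ a.map Prod.fst ++ [ζ] ∈ nodes (gammaInf ξ) ∧
      ∀ F ∈ finiteBallSets 𝕜 Ω, F ⊆ an 𝕜 Ω N → IsGood ξ r (a ++ [(ζ, F)]) := by
  obtain ⟨i, δ, h, hδ, H, hdom⟩ := ha
  have key : ∀ (i : ℕ) (δ : ℝ), δ < 1 → ∀ (ζ : Ordinal.{u}) (p : ℝ) (N : Set Ω),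
      (a.map Prod.fst ++ [ζ], p) ∈ infLevel ξ i → N.Finite →
      (∀ g, IsAnswer N g → Force (infLevel ξ i) (RankBound (Set.univ : Set Ω) (ω ^ ξ) r δ)
        (a.map Prod.fst ++ [ζ]) (h + p • g)) →
      ∃ (ζ : Ordinal.{u}) (N : Set Ω), N.Finite ∧ a.map Prod.fst ++ [ζ] ∈ nodes (gammaInf ξ) ∧
        ∀ F ∈ finiteBallSets 𝕜 Ω, F ⊆ an 𝕜 Ω N → IsGood ξ r (a ++ [(ζ, F)]) := by
    intro i δ hδ ζ p N hp hN hg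
    refine ⟨ζ, N, hN, mem_nodes_gammaInf.2 ⟨i, mem_nodes.2 ⟨p, hp⟩⟩, fun F hF hFN => ?_⟩
    obtain ⟨g, hg1, hg2⟩ := exists_isAnswer hF hFN
    exact ⟨i, δ, h + p • g, hδ, by simpa using hg g hg1,
      hdom.append (Set.mem_iUnion.2 ⟨i, hp⟩) hg2⟩
  cases H with
  | step _ _ ζ p N hp hN hg => exact key i δ hδ ζ p N hp hN hg
  | done _ _ ht hh =>
    -- At the end of a level the next one begins with the same accumulated sum and a larger `δ'`,
    -- still below `1`; this can be repeated forever.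
    obtain ⟨δ', h1, h2⟩ := exists_between hδ
    cases force_infLevel_succ hr h1 hh ht with
    | step _ _ ζ p N hp hN hg => exact key (i + 1) δ' h2 ζ p N hp hN hg
    | done _ _ ht' _ => exact absurd (infLevel_index_unique ht.1 ht'.1) (by omega)

/-- The levels are disjoint and the terms non-negative, so a sum over finitely many levels is at
most the sum over a long enough initial segment of the play. -/
theorem norm_partialSum_le {ξ : Ordinal.{u}} {τ : ℕ → Ordinal.{u}} {f : ℕ → C(Ω, 𝕜)} {c : ℝ}
    (hc : 0 ≤ c) (H : ∀ n x, ∑ k ∈ Finset.range n,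
      weight (gammaInf ξ) (initSeg τ (k + 1)) * ‖f k x‖ ≤ c) (m : ℕ) :
    ‖partialSum ξ τ f m‖ ≤ c := by
  rw [ContinuousMap.norm_le _ hc]
  intro x
  have e : partialSum ξ τ f m x = ∑ n ∈ Finset.range m, ∑ k ∈ (levelBlock_finite ξ τ n).toFinset,
      weight (gammaInf ξ) (initSeg τ (k + 1)) * ‖f k x‖ := by
    simp [partialSum, ContinuousMap.sum_apply, absFun]
  have hnn : ∀ k, 0 ≤ weight (gammaInf ξ) (initSeg τ (k + 1)) * ‖f k x‖ :=
    fun k => mul_nonneg (weight_nonneg ξ _) (norm_nonneg _)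
  rw [e, Real.norm_of_nonneg (Finset.sum_nonneg fun n _ => Finset.sum_nonneg fun k _ => hnn k),
    ← Finset.sum_biUnion]
  · obtain ⟨M, hM⟩ := Finset.exists_nat_subset_range
      ((Finset.range m).biUnion fun n => (levelBlock_finite ξ τ n).toFinset)
    exact (Finset.sum_le_sum_of_subset_of_nonneg hM fun k _ _ => hnn k).trans (H M x)
  · intro i _ j _ hij
    refine Finset.disjoint_left.2 fun k hi hj => hij ?_
    exact infLevel_index_unique ((levelBlock_finite ξ τ i).mem_toFinset.1 hi)
      ((levelBlock_finite ξ τ j).mem_toFinset.1 hj)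

theorem exists_strategy (𝕜 : Type*) [RCLike 𝕜] [Nonempty Ω] (ξ : Ordinal.{u}) (r : ℕ)
    (hr : iteratedDerivedSet (Set.univ : Set Ω) (ω ^ ξ * (r : Ordinal.{u})) = ∅) :
    ∃ χ : List (Ordinal.{u} × Set C(Ω, 𝕜)) → Ordinal.{u} × Set C(Ω, 𝕜),
      IsStrategyS (finiteAn 𝕜 Ω) (finiteBallSets 𝕜 Ω) (nodes (gammaInf ξ)) χ ∧
      ∀ a, a = [] ∨ a ∈ treeDot (nodes (gammaInf ξ)) (finiteBallSets 𝕜 Ω) → IsGood ξ r a →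
        ∀ F ∈ finiteBallSets 𝕜 Ω, F ⊆ (χ a).2 → IsGood ξ r (a ++ [((χ a).1, F)]) := by
  obtain ⟨x₀⟩ := ‹Nonempty Ω›
  -- Forcing at the root must begin with a move, since maximal nodes are non-empty; this yields a
  -- node of length one, from which new levels can be started.
  have hx : ∃ x, [x] ∈ nodes (gammaOne ξ) := by
    have h0 := force_infLevel_zero ξ hr one_pos
    cases h0 with
    | step _ _ ζ p N hp _ _ => exact ⟨ζ, mem_nodes.2 ⟨p, hp⟩⟩
    | done _ _ ht _ => exact absurd rfl ((gammaOne_props ξ).1 [] ht.1).1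
  obtain ⟨x, hx⟩ := hx
  have key : ∀ a : List (Ordinal.{u} × Set C(Ω, 𝕜)), ∃ q : Ordinal.{u} × Set C(Ω, 𝕜),
      a = [] ∨ a ∈ treeDot (nodes (gammaInf ξ)) (finiteBallSets 𝕜 Ω) →
      q.2 ∈ finiteAn 𝕜 Ω ∧ a.map Prod.fst ++ [q.1] ∈ nodes (gammaInf ξ) ∧
      (IsGood ξ r a → ∀ F ∈ finiteBallSets 𝕜 Ω, F ⊆ q.2 → IsGood ξ r (a ++ [(q.1, F)])) := by
    intro a
    by_cases ha : IsGood ξ r a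
    · obtain ⟨ζ, N, hN, hζ, H⟩ := ha.exists_step hr
      -- The point `x₀` makes the chosen set non-empty; enlarging it only restricts Player V.
      refine ⟨(ζ, an 𝕜 Ω (insert x₀ N)), fun _ =>
        ⟨⟨_, hN.insert x₀, Set.insert_nonempty _ _, rfl⟩, hζ, fun _ F hF hFN => H F hF ?_⟩⟩
      exact hFN.trans fun f hf y hy => hf y (Set.mem_insert_of_mem _ hy)
    · by_cases ht : a = [] ∨ a ∈ treeDot (nodes (gammaInf ξ)) (finiteBallSets 𝕜 Ω)
      · obtain ⟨ζ, hζ⟩ := exists_append_mem_gammaInf (t := a.map Prod.fst) hx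
          (ht.imp (by rintro rfl; rfl) fun h => h.1)
        -- A strategy must also move legally at positions that are not good, where any legal move
        -- will do.
        exact ⟨(ζ, an 𝕜 Ω {x₀}), fun _ => ⟨⟨_, Set.finite_singleton x₀,
          Set.singleton_nonempty x₀, rfl⟩, hζ, fun h => (ha h).elim⟩⟩
      · exact ⟨(0, ∅), fun h => (ht h).elim⟩
  choose χ hχ using key
  exact ⟨χ, ⟨fun a ha => (hχ a ha).1, fun a ha => (hχ a ha).2.1⟩, fun a ha => (hχ a ha).2.2⟩

theorem initSeg_mem_treeDot {A B : Type*} {T : Set (List A)} {𝔤 : Set B} {α : ℕ → A × B}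
    (hα : α ∈ bodyDot T 𝔤) (n : ℕ) : initSeg α n = [] ∨ initSeg α n ∈ treeDot T 𝔤 := by
  rcases Nat.eq_zero_or_pos n with rfl | hn
  · exact Or.inl rfl
  · refine Or.inr ⟨?_, fun x hx => ?_⟩
    · rw [map_initSeg]
      exact hα.1 n hn
    · obtain ⟨k, -, rfl⟩ := List.mem_map.1 hx
      exact hα.2 k

end Game

end CKGame

theorem mainTheorem10 {𝕜 : Type*} [RCLike 𝕜] {Ω : Type u} [TopologicalSpace Ω] [CompactSpace Ω]
    [T2Space Ω] (hΩ : CKGame.IsScattered Ω) (ξ : Ordinal.{u}) (r : ℕ) (hr : 0 < r)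
    (h_ne : (CantorBendixson.iteratedDerivedSet (Set.univ : Set Ω)
      (Ordinal.omega0 ^ ξ * ((r - 1 : ℕ) : Ordinal.{u}))).Nonempty)
    (h_empty : CantorBendixson.iteratedDerivedSet (Set.univ : Set Ω)
      (Ordinal.omega0 ^ ξ * (r : Ordinal.{u})) = ∅)
    (C : ℝ) (hC : (2 : ℝ) ^ r < C) :
    ∃ χ : List (Ordinal.{u} × Set C(Ω, 𝕜)) → Ordinal.{u} × Set C(Ω, 𝕜),
      CKGame.IsWinningStrategyS (CKGame.targetSet 𝕜 Ω ξ C) (CKGame.finiteAn 𝕜 Ω)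
        (CKGame.finiteBallSets 𝕜 Ω) (CKGame.nodes (CKGame.gammaInf ξ)) χ := by
  have : Nonempty Ω := ⟨h_ne.some⟩
  -- The strategy keeps all sums below `r`, which is less than `2 ^ r`.
  have hrC : (r : ℝ) ≤ C := by
    have h1 : (r : ℝ) < 2 ^ r := by exact_mod_cast Nat.lt_two_pow_self (n := r)
    linarith
  obtain ⟨χ, hχ, hgood⟩ := CKGame.exists_strategy 𝕜 ξ r h_empty
  refine ⟨χ, hχ, fun α hα hadm => ⟨hα, fun f hf m => ?_⟩⟩
  have hn : ∀ n, CKGame.IsGood ξ r (CKGame.initSeg α n) := by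
    intro n
    induction n with
    | zero => exact CKGame.isGood_nil h_empty
    | succ n ih =>
      rw [CKGame.initSeg_succ, ← Prod.mk.eta (p := α n), (hadm n).1]
      exact hgood _ (CKGame.initSeg_mem_treeDot hα n) ih _ (hα.2 n) (hadm n).2
  exact (CKGame.norm_partialSum_le r.cast_nonneg (fun n x => (hn n).sum_le hf x) m).trans hrC
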